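/- There is a universal constant $C>0$ with the following property. Let $n\ge 3$, let $d_1,\dots,d_{n-1}\ge 1$ be integers with $d:=\max_i d_i\ge 2$, and set $N_i:=\binom{n+d_i-1}{d_i}$ and $N:=\sum_{i=1}^{n-1}N_i$. Let $P=(p_1,\dots,p_{n-1})$ be the random system of homogeneous polynomials in $n$ variables $$p_i(x)=\sum_{\alpha_1+\cdots+\alpha_n=d_i}\sqrt{\tbinom{d_i}{\alpha}}\;c_{i,\alpha}\,x^\alpha ,\qquad \tbinom{d_i}{\alpha}=\frac{d_i!}{\alpha_1!\cdots\alpha_n!},$$ where the random vectors $C_i=(c_{i,\alpha})_\alpha\in\mathbb R^{N_i}$, $1\le i\le n-1$, are independent and, for some $K,c_0>0$ and every $i$, satisfy * (Sub-Gaussian) $\mathrm{Prob}(|\langle C_i,\theta\rangle|\ge t)\le 2e^{-t^2/K^2}$ for all unit vectors $\theta\in\mathbb R^{N_i}$ and all $t>0$; * (Small Ball) $\mathrm{Prob}(|\langle a,C_i\rangle|\le\varepsilon\|a\|_2)\le c_0\varepsilon$ for all nonzero $a\in\mathbb R^{N_i}$ and all $\varepsilon>0$. For a system $P$ of homogeneous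 polynomials of degrees $d_1,\dots,d_{n-1}$ let $\|P\|_W=\big(\sum_i\sum_{|\alpha|=d_i}|\mathrm{coeff}_\alpha(p_i)|^2/\binom{d_i}{\alpha}\big)^{1/2}$ be its Weyl-Bombieri norm. For $x\in S^{n-1}$ set $$L(P,x)=\sqrt{\sigma_{\min}\big(\Delta^{-1}DP(x)|_{T_xS^{n-1}}\big)^2+\|P(x)\|_2^2},\qquad \Delta=\mathrm{diag}(\sqrt{d_1},\dots,\sqrt{d_{n-1}}),$$ where $DP(x)$ is the Jacobian matrix, $T_xS^{n-1}=x^\perp$, and $\sigma_{\min}$ is the smallest singular value. Let $\tilde\kappa(P)=\sup_{x\in S^{n-1}}\|P\|_W/L(P,x)\in[0,\infty]$, a quotient with $L(P,x)=0$ being $\infty$. Put $$M:=\sqrt N\,(Kc_0C)^{2(n-1)}\,(3d^2\log(ed))^{2n-3}\,\sqrt n .$$ Then $$\mathrm{Prob}(\tilde\kappa(P)\ge tM)\le\begin{cases}3t^{-1/2}&\text{if }1\le t\le e^{2(n-1)\log(ed)},\\[4pt] 3t^{-1/2}\left(\dfrac{\log t}{2(n-1)\log(ed)}\right)^{\frac{n-3/2}{2}}&\text{if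 }e^{2(n-1)\log(ed)}\le t\le e^{2N},\\[8pt] 3t^{-1/2}\left(\dfrac{\log t}{2N}\right)^{1/4}\left(\dfrac{\log t}{2(n-1)\log(ed)}\right)^{\frac{n-3/2}{2}}&\text{if }t\ge e^{2N}.\end{cases}$$ For every $q\in\left(0,\frac12-\frac1{4\log(ed)}\right]$ we have $\big(\mathbb E\,\tilde\kappa(P)^q\big)^{1/q}\le M e^{1/q}$. Finally, $0<\tilde\kappa(P)<\infty$ almost surely, $\log\tilde\kappa(P)$ is integrable, and $\mathbb E\log\tilde\kappa(P)\le 1+\log M$. -/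

import Mathlib

open MeasureTheory ProbabilityTheory
open scoped ENNReal

noncomputable section

namespace RandomSystem

/-- The multi-indices `α = (α₁, …, αₙ)` of natural numbers with `α₁ + ⋯ + αₙ = k`;
there are `(n + k - 1).choose k` of them. -/
abbrev MultiIndex (n k : ℕ) : Type :=
  ↥(Finset.finsuppAntidiag (Finset.univ : Finset (Fin n)) k)

/-- The homogeneous polynomial `∑_{|α| = k} √(k! / (α₁! ⋯ αₙ!)) c_α x^α` of degree `k` in `n`
variables with (scaled) coefficient vector `c`. -/
def formOfCoeffs {n k : ℕ} (c : EuclideanSpace ℝ (MultiIndex n k)) : MvPolynomial (Fin n) ℝ :=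
  ∑ α : MultiIndex n k,
    MvPolynomial.monomial (α : Fin n →₀ ℕ) (√((α : Fin n →₀ ℕ).multinomial : ℝ) * c α)

/-- The squared Weyl-Bombieri norm `∑_{|α| = k} |coeff_α p|² / (k! / (α₁! ⋯ αₙ!))` of a
homogeneous polynomial `p` of degree `k`. -/
def weylSq {n : ℕ} (k : ℕ) (p : MvPolynomial (Fin n) ℝ) : ℝ :=
  ∑ α : MultiIndex n k, p.coeff (α : Fin n →₀ ℕ) ^ 2 / ((α : Fin n →₀ ℕ).multinomial : ℝ)

/-- The Weyl-Bombieri norm of a system `P = (p₁, …, pₘ)` of homogeneous polynomials of degrees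
`deg 1, …, deg m`. -/
def weylNorm {n m : ℕ} (deg : Fin m → ℕ) (P : Fin m → MvPolynomial (Fin n) ℝ) : ℝ :=
  √(∑ i, weylSq (deg i) (P i))

/-- The value `P(x) = (p₁(x), …, pₘ(x))`. -/
def evalSystem {n m : ℕ} (P : Fin m → MvPolynomial (Fin n) ℝ) (x : EuclideanSpace ℝ (Fin n)) :
    EuclideanSpace ℝ (Fin m) :=
  WithLp.toLp 2 fun i => MvPolynomial.eval (fun j => x j) (P i)

/-- The `m × n` Jacobian matrix `DP(x)`. -/
def jacobian {n m : ℕ} (P : Fin m → MvPolynomial (Fin n) ℝ) (x : EuclideanSpace ℝ (Fin n)) :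
    Matrix (Fin m) (Fin n) ℝ :=
  Matrix.of fun i j => MvPolynomial.eval (fun l => x l) (MvPolynomial.pderiv j (P i))

/-- `Δₘ`, the diagonal matrix with diagonal entries `√(deg 1), …, √(deg m)`. -/
def degMatrix {m : ℕ} (deg : Fin m → ℕ) : Matrix (Fin m) (Fin m) ℝ :=
  Matrix.diagonal fun i => √(deg i : ℝ)

/-- The linear map `Δₘ⁻¹ DP(x)` restricted to `T_x Sⁿ⁻¹`, where the tangent space of the unit
sphere at `x` is the orthogonal complement of `x`, with the induced inner product. -/
def scaledTangentDeriv {n m : ℕ} (deg : Fin m → ℕ) (P : Fin m → MvPolynomial (Fin n) ℝ)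
    (x : EuclideanSpace ℝ (Fin n)) : ↥((ℝ ∙ x)ᗮ) →ₗ[ℝ] EuclideanSpace ℝ (Fin m) :=
  (Matrix.toEuclideanLin ((degMatrix deg)⁻¹ * jacobian P x)).comp ((ℝ ∙ x)ᗮ).subtype

/-- The smallest singular value of a linear map `T` on `E`, i.e. the least of the `dim E` square
roots of the eigenvalues of `T† T` (Mathlib lists them in decreasing order, starting at index 0). -/
def minSingularValue {E F : Type*} [NormedAddCommGroup E] [InnerProductSpace ℝ E]
    [FiniteDimensional ℝ E] [NormedAddCommGroup F] [InnerProductSpace ℝ F]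
    [FiniteDimensional ℝ F] (T : E →ₗ[ℝ] F) : ℝ :=
  T.singularValues (Module.finrank ℝ E - 1)

/-- `L(P, x) = √(σ_min(Δₘ⁻¹ DP(x)|_{T_x Sⁿ⁻¹})² + ‖P(x)‖₂²)`. -/
def localL {n m : ℕ} (deg : Fin m → ℕ) (P : Fin m → MvPolynomial (Fin n) ℝ)
    (x : EuclideanSpace ℝ (Fin n)) : ℝ :=
  √(minSingularValue (scaledTangentDeriv deg P x) ^ 2 + ‖evalSystem P x‖ ^ 2)

/-- The local condition number `‖P‖_W / L(P, x)`, which is `∞` where `L(P, x) = 0`. -/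
def localKappa {n m : ℕ} (deg : Fin m → ℕ) (P : Fin m → MvPolynomial (Fin n) ℝ)
    (x : EuclideanSpace ℝ (Fin n)) : ℝ≥0∞ :=
  if localL deg P x = 0 then ∞ else ENNReal.ofReal (weylNorm deg P / localL deg P x)

/-- The global condition number: the supremum of the local one over the unit sphere. -/
def kappa {n m : ℕ} (deg : Fin m → ℕ) (P : Fin m → MvPolynomial (Fin n) ℝ) : ℝ≥0∞ :=
  ⨆ x ∈ Metric.sphere (0 : EuclideanSpace ℝ (Fin n)) 1, localKappa deg P x

/-- The Sub-Gaussian assumption with constant `K` for a random vector `X` in `ℝ^ι`. -/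
def SubGaussianWith {Ω ι : Type*} [MeasurableSpace Ω] [Fintype ι] (μ : Measure Ω)
    (X : Ω → EuclideanSpace ℝ ι) (K : ℝ) : Prop :=
  ∀ θ : EuclideanSpace ℝ ι, ‖θ‖ = 1 → ∀ t : ℝ, 0 < t →
    μ.real {ω | t ≤ |inner ℝ (X ω) θ|} ≤ 2 * Real.exp (-t ^ 2 / K ^ 2)

/-- The Small Ball assumption with constant `c₀` for a random vector `X` in `ℝ^ι`. -/
def SmallBallWith {Ω ι : Type*} [MeasurableSpace Ω] [Fintype ι] (μ : Measure Ω)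
    (X : Ω → EuclideanSpace ℝ ι) (c₀ : ℝ) : Prop :=
  ∀ a : EuclideanSpace ℝ ι, a ≠ 0 → ∀ ε : ℝ, 0 < ε →
    μ.real {ω | |inner ℝ a (X ω)| ≤ ε * ‖a‖} ≤ c₀ * ε

end RandomSystem

end

/-! By Cauchy–Schwarz and the multinomial theorem, `P(x)` on the sphere is a vector of products of
the `C_i` with unit vectors, so both hypotheses apply at each fixed point. Passing from one point to
all points is done without nets, by a volume argument. If a bad event forces some functional `h(P,
·) ≥ q` on a box occupying a fraction `1 / R` of a ball, then Markov and Tonelli bound its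
probability by `R q⁻¹ sup_w E h(P, w)` (`mul_measure_le_of_exists_large_set`).

Spreading a bad point to a box uses Bernstein inequalities along great circles (`bernstein_forms`).
There `P(cos t x + sin t y)` extends to an entire function of exponential type `d`, and
Phragmén–Lindelöf with Cauchy estimates bounds its first two derivatives by `3dΓ` and `9d²Γ`, where
`Γ` bounds `‖P‖` on the sphere.

For the upper bound take `h = exp(‖P‖² / 2K²)`: near a maximum the system keeps half its size
(`measure_exists_lt_norm_evalSystem_le`). For the lower bound take `h = exp(-‖P‖² / ε²)`. A large
condition number yields orthonormal `x, y` with `P(x)` and `DP(x) y` both of order `α = ρ² γ`, where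
`γ` bounds `‖P‖`. Since the first-order term in the direction `y` is also small, the box may have
width of order `ρ / d` along `y`, against `ρ² / d` in the other `n - 2` tangent directions. Its
volume is of order `ρ^(2n-3)`, while the small ball probability is of order `α^(n-1)`, that is
`ρ^(2n-2)`. One factor `ρ` survives, and `ρ²` is of order `1 / t`; this is the exponent `-1/2`
(`measure_exists_small_le`).

The tail bound (`measure_le_kappa_forms_le`) is a union over three events: large Weyl norm, large
maximum, and small values on a system with controlled maximum. The truncation levels grow with `log
t`, which produces the logarithmic factors. The bound proved has a spare factor `1 / (8d)`. It makes
the moment of order `q` of `κ / M` at most `1 + q`, from which both the moment bound and, through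
`log y ≤ (y^q - 1) / q`, the estimate of the expected logarithm follow (`moments_of_tail`). -/

namespace RandomSystem

/-! ### Bernstein inequalities for entire functions of exponential type. -/

section ExponentialType

/-- An entire function of exponential type `d` along the imaginary direction which is bounded by
`Γ` on the real line is bounded by `Γ exp (d |Im ζ|)`. -/
lemma norm_le_exp_of_exponentialType {f : ℂ → ℂ} {d A Γ : ℝ} (hf : Differentiable ℂ f)
    (hA : ∀ ζ, ‖f ζ‖ ≤ A * Real.exp (d * |ζ.im|)) (hΓ : ∀ t : ℝ, ‖f t‖ ≤ Γ) (ζ : ℂ) :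
    ‖f ζ‖ ≤ Γ * Real.exp (d * |ζ.im|) := by
  have key : ∀ g : ℂ → ℂ, Differentiable ℂ g → (∀ ζ, ‖g ζ‖ ≤ A * Real.exp (d * |ζ.im|)) →
      (∀ t : ℝ, ‖g t‖ ≤ Γ) → ∀ z : ℂ, 0 ≤ z.re →
      ‖g (Complex.I * z)‖ ≤ Γ * Real.exp (d * z.re) := by
    intro g hg hgA hgΓ z hz
    -- Multiplying by `exp (-d w)` cancels the exponential growth without changing the modulus on
    -- the imaginary axis, so Phragmén–Lindelöf carries the bound `Γ` from there into the
    -- half-plane.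
    have hb : ∀ w : ℂ, 0 ≤ w.re → ‖g (Complex.I * w) * Complex.exp (-d * w)‖ ≤ A := by
      intro w hw
      rw [norm_mul, Complex.norm_exp]
      have h1 := hgA (Complex.I * w)
      have h2 : (Complex.I * w).im = w.re := by simp
      have h3 : (-(d : ℂ) * w).re = -(d * w.re) := by simp
      rw [h2, abs_of_nonneg hw] at h1
      rw [h3, Real.exp_neg]
      have h4 := Real.exp_pos (d * w.re)
      rw [← div_eq_mul_inv, div_le_iff₀ h4]
      exact h1
    have h := PhragmenLindelof.right_half_plane_of_bounded_on_real
      (f := fun w => g (Complex.I * w) * Complex.exp (-d * w)) (C := Γ) (z := z) ?_ ?_ ?_ ?_ hz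
    · rw [norm_mul, Complex.norm_exp] at h
      have h3 : (-(d : ℂ) * z).re = -(d * z.re) := by simp
      rw [h3, Real.exp_neg, ← div_eq_mul_inv, div_le_iff₀ (Real.exp_pos _)] at h
      exact h
    · apply Differentiable.diffContOnCl
      fun_prop
    · refine ⟨0, by norm_num, 0, ?_⟩
      refine Asymptotics.IsBigO.of_bound A ?_
      refine Filter.mem_inf_of_right ?_
      intro w hw
      simpa using hb w (le_of_lt hw)
    · refine ⟨A, ?_⟩
      rw [Filter.eventually_map]
      filter_upwards [Filter.eventually_ge_atTop 0] with x hx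
      exact hb x (by simpa using hx)
    · intro x
      rw [norm_mul, Complex.norm_exp]
      have h1 : Complex.I * ((x : ℂ) * Complex.I) = ((-x : ℝ) : ℂ) := by
        push_cast
        linear_combination (x : ℂ) * Complex.I_mul_I
      have h3 : (-(d : ℂ) * ((x : ℂ) * Complex.I)).re = 0 := by simp
      rw [h1, h3, Real.exp_zero, mul_one]
      exact hgΓ _
  -- The lower half-plane is reduced to the upper one by `z ↦ -z`.
  rcases le_total 0 ζ.im with h | h
  · have := key f hf hA hΓ (-Complex.I * ζ) (by simpa using h)
    have e : Complex.I * (-Complex.I * ζ) = ζ := by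
      linear_combination (-ζ) * Complex.I_mul_I
    rw [e] at this
    simpa [abs_of_nonneg h] using this
  · have := key (fun z => f (-z)) (by fun_prop) (fun z => by simpa using hA (-z))
      (fun t => by simpa using hΓ (-t)) (Complex.I * ζ) (by simpa using h)
    have e : -(Complex.I * (Complex.I * ζ)) = ζ := by
      linear_combination (-ζ) * Complex.I_mul_I
    simp only [e] at this
    simpa [abs_of_nonpos h] using this

/-- Bernstein's inequality in a strip, up to a constant. -/
lemma norm_deriv_le_of_exponentialType {f : ℂ → ℂ} {d B h : ℝ} (hd : 0 < d)
    (hf : Differentiable ℂ f)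
    (hB : ∀ ζ : ℂ, |ζ.im| ≤ h + 1 / d → ‖f ζ‖ ≤ B) {z : ℂ} (hz : |z.im| ≤ h) :
    ‖deriv f z‖ ≤ B * d := by
  have h1 := Complex.norm_deriv_le_of_forall_mem_sphere_norm_le (c := z) (R := 1 / d) (C := B)
    (by positivity) hf.diffContOnCl (fun w hw => by
      apply hB
      have h2 : |(w - z).im| ≤ ‖w - z‖ := Complex.abs_im_le_norm _
      rw [mem_sphere_iff_norm.1 hw] at h2
      have h3 : w.im = z.im + (w - z).im := by simp
      rw [h3]
      exact (abs_add_le _ _).trans (add_le_add hz h2))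
  simpa using h1

/-- Each Cauchy estimate uses a disc of radius `1 / d`, on which the strip bound loses at most a
factor `e ≤ 3`. One derivative therefore costs `3d` and two cost `9d²`; the mean value inequality on
the real axis does the rest. -/
lemma taylor_of_exponentialType {f : ℂ → ℂ} {d A Γ : ℝ} (hd : 0 < d) (hf : Differentiable ℂ f)
    (hA : ∀ ζ, ‖f ζ‖ ≤ A * Real.exp (d * |ζ.im|)) (hΓ : ∀ t : ℝ, ‖f t‖ ≤ Γ) (t : ℝ) :
    ‖deriv f t‖ ≤ 3 * d * Γ ∧ ‖f t - f 0‖ ≤ 3 * d * Γ * |t| ∧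
      ‖f t - f 0 - t * deriv f 0‖ ≤ 9 * d ^ 2 * Γ * t ^ 2 := by
  have hΓ0 : 0 ≤ Γ := (norm_nonneg _).trans (hΓ 0)
  have hstrip := norm_le_exp_of_exponentialType hf hA hΓ
  have he1 : Real.exp 1 ≤ 3 := by linarith [Real.exp_one_lt_d9]
  have hb : ∀ k : ℕ, ∀ ζ : ℂ, |ζ.im| ≤ k / d → ‖f ζ‖ ≤ Γ * 3 ^ k := by
    intro k ζ hζ
    refine (hstrip ζ).trans (mul_le_mul_of_nonneg_left ?_ hΓ0)
    have : d * |ζ.im| ≤ k * 1 := by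
      rw [mul_one, ← div_mul_cancel₀ (k : ℝ) hd.ne', mul_comm d]
      gcongr
    refine (Real.exp_le_exp.2 this).trans ?_
    rw [Real.exp_nat_mul]
    gcongr
  have hd1 : ∀ z : ℂ, z.im = 0 → ‖deriv f z‖ ≤ 3 * d * Γ := by
    intro z hz
    have := norm_deriv_le_of_exponentialType (B := Γ * 3) (h := 0) hd hf
      (fun ζ h => by simpa using hb 1 ζ (by simpa using h)) (z := z) (by simp [hz])
    linarith
  have hd2 : ∀ z : ℂ, z.im = 0 → ‖deriv (deriv f) z‖ ≤ 9 * d ^ 2 * Γ := by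
    intro z hz
    have := norm_deriv_le_of_exponentialType (f := deriv f) (B := Γ * 9 * d) (h := 0) hd
      (hf.contDiff (n := 2)).differentiable_deriv_two
      (fun ζ h => norm_deriv_le_of_exponentialType (h := 1 / d) hd hf
        (fun w h => by
          have := hb 2 w (by
            refine h.trans (le_of_eq ?_)
            push_cast; ring)
          norm_num at this ⊢
          exact this) (by simpa using h)) (z := z) (by simp [hz])
    calc _ ≤ _ := this
      _ = _ := by ring
  have hconv : Convex ℝ {z : ℂ | z.im = 0} := by
    intro x hx y hy a b _ _ _
    simp only [Set.mem_ofPred_eq] at *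
    simp [hx, hy]
  refine ⟨hd1 t (by simp), ?_, ?_⟩
  · have := hconv.norm_image_sub_le_of_norm_deriv_le (f := f) (C := 3 * d * Γ)
      (fun x _ => hf x) (fun x hx => hd1 x hx) (x := 0) (y := t) Complex.zero_im (Complex.ofReal_im t)
    simpa using this
  · have hdf : Differentiable ℂ (deriv f) := (hf.contDiff (n := 2)).differentiable_deriv_two
    have h1 : ∀ z : ℂ, z.im = 0 → ‖deriv f z - deriv f 0‖ ≤ 9 * d ^ 2 * Γ * ‖z‖ := by
      intro z hz
      have := hconv.norm_image_sub_le_of_norm_deriv_le (f := deriv f) (C := 9 * d ^ 2 * Γ)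
        (fun x _ => hdf x) (fun x hx => hd2 x hx) (x := 0) (y := z) Complex.zero_im hz
      simpa using this
    -- The bound for `deriv f z - deriv f 0` grows with `‖z‖`, so the mean value inequality is used
    -- only where `‖z‖ ≤ |t|`. This loses the factor `1/2` of Taylor's formula.
    have hconv2 : Convex ℝ ({z : ℂ | z.im = 0} ∩ Metric.closedBall 0 |t|) :=
      hconv.inter (convex_closedBall _ _)
    have hg : ∀ x : ℂ, HasDerivAt (fun z => f z - z * deriv f 0) (deriv f x - deriv f 0) x := by
      intro x
      have := (hf x).hasDerivAt.sub ((hasDerivAt_id x).mul_const (deriv f 0))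
      rw [one_mul] at this
      exact this
    have := hconv2.norm_image_sub_le_of_norm_deriv_le (f := fun z => f z - z * deriv f 0)
      (C := 9 * d ^ 2 * Γ * |t|) (fun x _ => (hg x).differentiableAt)
      (fun x hx => by
        rw [(hg x).deriv]
        refine (h1 x hx.1).trans ?_
        have := mem_closedBall_zero_iff.1 hx.2
        gcongr) (x := 0) (y := t)
      ⟨Complex.zero_im, by simp⟩ ⟨Complex.ofReal_im t, by simp⟩
    have e : f t - f 0 - t * deriv f 0 = f t - t * deriv f 0 - (f 0 - 0 * deriv f 0) := by ring
    rw [e]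
    refine this.trans (le_of_eq ?_)
    rw [sub_zero, Complex.norm_real, Real.norm_eq_abs, mul_assoc _ |t|, abs_mul_abs_self, sq t]

end ExponentialType

/-! ### The smallest singular value as a minimum over unit vectors. -/

section SingularValue

variable {E F : Type*} [NormedAddCommGroup E] [InnerProductSpace ℝ E]
    [FiniteDimensional ℝ E] [NormedAddCommGroup F] [InnerProductSpace ℝ F]
    [FiniteDimensional ℝ F]

lemma minSingularValue_nonneg (T : E →ₗ[ℝ] F) : 0 ≤ minSingularValue T :=
  T.singularValues_nonneg _

/-- Expand `y` in an eigenbasis of `T† T`: `‖T y‖²` is an average of the eigenvalues with weights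
summing to `‖y‖² = 1`. -/
lemma minSingularValue_le (T : E →ₗ[ℝ] F) {y : E} (hy : ‖y‖ = 1) :
    minSingularValue T ≤ ‖T y‖ := by
  have hS := T.isSymmetric_adjoint_comp_self
  set b := hS.eigenvectorBasis rfl
  have h1 : ‖T y‖ ^ 2 = ∑ i, hS.eigenvalues rfl i * (b.repr y i) ^ 2 := by
    have : ‖T y‖ ^ 2 = inner ℝ y ((LinearMap.adjoint T ∘ₗ T) y) := by
      rw [LinearMap.comp_apply, LinearMap.adjoint_inner_right, real_inner_self_eq_norm_sq]
    rw [this, ← b.repr.inner_map_map]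
    simp only [PiLp.inner_apply, b, hS.eigenvectorBasis_apply_self_apply]
    refine Finset.sum_congr rfl fun i _ => ?_
    simp
    ring
  have h2 : ‖y‖ ^ 2 = ∑ i, (b.repr y i) ^ 2 := by
    rw [← b.repr.norm_map, EuclideanSpace.real_norm_sq_eq]
  have h3 : minSingularValue T ^ 2 ≤ ‖T y‖ ^ 2 := by
    rw [h1, ← mul_one (minSingularValue T ^ 2), ← one_pow 2, ← hy, h2, Finset.mul_sum]
    refine Finset.sum_le_sum fun i _ => mul_le_mul_of_nonneg_right ?_ (sq_nonneg _)
    rw [← T.sq_singularValues_fin rfl i]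
    exact pow_le_pow_left₀ (minSingularValue_nonneg T)
      (T.singularValues_antitone (by have := i.2; omega)) 2
  exact le_of_sq_le_sq h3 (norm_nonneg _)

lemma exists_norm_eq_minSingularValue (T : E →ₗ[ℝ] F) (hE : 0 < Module.finrank ℝ E) :
    ∃ y : E, ‖y‖ = 1 ∧ ‖T y‖ = minSingularValue T := by
  have hS := T.isSymmetric_adjoint_comp_self
  let i : Fin (Module.finrank ℝ E) := ⟨Module.finrank ℝ E - 1, by omega⟩
  refine ⟨hS.eigenvectorBasis rfl i, (hS.eigenvectorBasis rfl).orthonormal.1 i, ?_⟩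
  have h : ‖T (hS.eigenvectorBasis rfl i)‖ ^ 2 = minSingularValue T ^ 2 := by
    have : ‖T (hS.eigenvectorBasis rfl i)‖ ^ 2
        = inner ℝ (hS.eigenvectorBasis rfl i)
          ((LinearMap.adjoint T ∘ₗ T) (hS.eigenvectorBasis rfl i)) := by
      rw [LinearMap.comp_apply, LinearMap.adjoint_inner_right, real_inner_self_eq_norm_sq]
    rw [this, hS.apply_eigenvectorBasis, inner_smul_right, real_inner_self_eq_norm_sq,
      (hS.eigenvectorBasis rfl).orthonormal.1 i]
    rw [minSingularValue, T.sq_singularValues_fin rfl i]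
    simp
  exact (sq_eq_sq₀ (norm_nonneg _) (minSingularValue_nonneg T)).1 h

end SingularValue

/-! ### Weyl-scaled forms, their evaluation vectors and complexification. -/

section Forms

variable {n m k : ℕ}

/-- The scaled monomials of degree `k`, as a vector of the coefficient space. -/
noncomputable def feat (k : ℕ) (x : EuclideanSpace ℝ (Fin n)) :
    EuclideanSpace ℝ (MultiIndex n k) :=
  WithLp.toLp 2 fun α => √((α : Fin n →₀ ℕ).multinomial : ℝ) * ∏ j, x j ^ (α : Fin n →₀ ℕ) j

lemma sum_multiIndex (α : MultiIndex n k) : ∑ j, (α : Fin n →₀ ℕ) j = k :=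
  (Finset.mem_finsuppAntidiag.1 α.2).1

lemma formOfCoeffs_eq_sum_smul (c : EuclideanSpace ℝ (MultiIndex n k)) :
    formOfCoeffs c = ∑ α : MultiIndex n k, c α •
      MvPolynomial.monomial (α : Fin n →₀ ℕ) (√((α : Fin n →₀ ℕ).multinomial : ℝ)) := by
  refine Finset.sum_congr rfl fun α _ => ?_
  rw [MvPolynomial.smul_monomial, smul_eq_mul, mul_comm]

lemma eval_formOfCoeffs (c : EuclideanSpace ℝ (MultiIndex n k)) (x : EuclideanSpace ℝ (Fin n)) :
    MvPolynomial.eval (fun j => x j) (formOfCoeffs c) = inner ℝ (feat k x) c := by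
  simp only [formOfCoeffs, map_sum, MvPolynomial.eval_monomial, feat, PiLp.inner_apply]
  refine Finset.sum_congr rfl fun α _ => ?_
  rw [Finsupp.prod_fintype _ _ (by simp)]
  simp
  ring

/-- The squared norm is the multinomial expansion of `(∑ x_j²)^k`; the Weyl scaling of the
coefficients is made for this. -/
lemma norm_feat (x : EuclideanSpace ℝ (Fin n)) : ‖feat k x‖ = ‖x‖ ^ k := by
  have h : ‖feat k x‖ ^ 2 = (‖x‖ ^ k) ^ 2 := by
    rw [← pow_mul, mul_comm k, pow_mul, EuclideanSpace.real_norm_sq_eq,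
      EuclideanSpace.real_norm_sq_eq, Finset.sum_pow_eq_sum_piAntidiag]
    refine Finset.sum_bij (fun (α : MultiIndex n k) _ => ((α : Fin n →₀ ℕ) : Fin n → ℕ))
      (fun α _ => by simpa using sum_multiIndex α)
      (fun α _ β _ h => Subtype.ext (DFunLike.coe_injective h))
      (fun f hf => ⟨⟨Finsupp.equivFunOnFinite.symm f, by simpa using hf⟩, by simp, rfl⟩)
      fun α _ => ?_
    have h1 : (α : Fin n →₀ ℕ).multinomial = Nat.multinomial Finset.univ (α : Fin n →₀ ℕ) :=
      Finsupp.multinomial_eq_of_support_subset (Finset.subset_univ _)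
    simp only [feat, mul_pow, Real.sq_sqrt (Nat.cast_nonneg _), h1]
    rw [← Finset.prod_pow]
    congr 1
    refine Finset.prod_congr rfl fun j _ => ?_
    rw [← pow_mul, ← pow_mul, mul_comm]
  exact (sq_eq_sq₀ (norm_nonneg _) (by positivity)).1 h

lemma continuous_feat : Continuous (feat k : EuclideanSpace ℝ (Fin n) → _) := by
  unfold feat
  fun_prop

lemma weylSq_formOfCoeffs (c : EuclideanSpace ℝ (MultiIndex n k)) :
    weylSq k (formOfCoeffs c) = ‖c‖ ^ 2 := by
  rw [weylSq, EuclideanSpace.real_norm_sq_eq]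
  refine Finset.sum_congr rfl fun α _ => ?_
  have h1 : (formOfCoeffs c).coeff (α : Fin n →₀ ℕ)
      = √((α : Fin n →₀ ℕ).multinomial : ℝ) * c α := by
    rw [formOfCoeffs, MvPolynomial.coeff_sum, Finset.sum_eq_single α]
    · simp
    · intro β _ hβ
      rw [MvPolynomial.coeff_monomial, if_neg fun h => hβ (Subtype.ext h)]
    · simp
  have h2 : (0 : ℝ) < ((α : Fin n →₀ ℕ).multinomial : ℝ) := by
    exact_mod_cast Nat.multinomial_pos _ _
  rw [h1, mul_pow, Real.sq_sqrt h2.le]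
  field_simp

lemma card_multiIndex : Fintype.card (MultiIndex n k) = (n + k - 1).choose k := by
  rw [Fintype.card_coe, Finset.card_finsuppAntidiag_nat_eq_choose, Finset.card_univ,
    Fintype.card_fin]

lemma hasDerivAt_aeval (p : MvPolynomial (Fin n) ℝ) {g : Fin n → ℂ → ℂ} {g' : Fin n → ℂ} {ζ : ℂ}
    (hg : ∀ j, HasDerivAt (g j) (g' j) ζ) :
    HasDerivAt (fun z => MvPolynomial.aeval (fun j => g j z) p)
      (∑ j, MvPolynomial.aeval (fun j => g j ζ) (MvPolynomial.pderiv j p) * g' j) ζ := by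
  induction p using MvPolynomial.induction_on with
  | C a => simpa using hasDerivAt_const ζ (a : ℂ)
  | add p q hp hq =>
    simp only [map_add, add_mul, Finset.sum_add_distrib]
    exact hp.add hq
  | mul_X p i hp =>
    have h := hp.mul (hg i)
    simp only [map_mul, MvPolynomial.aeval_X]
    refine h.congr_deriv ?_
    simp only [Derivation.leibniz, MvPolynomial.pderiv_X, smul_eq_mul, map_add, map_mul,
      MvPolynomial.aeval_X, add_mul, Finset.sum_add_distrib, Finset.sum_mul]
    rw [add_comm]
    congr 1
    · rw [Finset.sum_eq_single i]
      · simp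
      · intro j _ hj
        simp [hj.symm]
      · simp
    · refine Finset.sum_congr rfl fun j _ => ?_
      ring

lemma aeval_ofReal (p : MvPolynomial (Fin n) ℝ) (x : Fin n → ℝ) :
    MvPolynomial.aeval (fun j => (x j : ℂ)) p = ((MvPolynomial.eval x p : ℝ) : ℂ) := by
  have := MvPolynomial.aeval_algebraMap_apply ℂ x p
  rw [← MvPolynomial.coe_aeval_eq_eval]
  exact this

/-- By homogeneity a common factor `s` of the coordinates leaves every monomial as `s^k`. With `s =
exp |Im ζ|` this shows that forms along complexified great circles have exponential type. -/
lemma norm_aeval_formOfCoeffs_le (c : EuclideanSpace ℝ (MultiIndex n k)) (z : Fin n → ℂ)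
    (r : Fin n → ℝ) (s : ℝ) (hz : ∀ j, ‖z j‖ ≤ s * r j) :
    ‖MvPolynomial.aeval z (formOfCoeffs c)‖
      ≤ (∑ α : MultiIndex n k, |√((α : Fin n →₀ ℕ).multinomial : ℝ) * c α| *
        ∏ j, r j ^ (α : Fin n →₀ ℕ) j) * s ^ k := by
  rw [formOfCoeffs, map_sum, Finset.sum_mul]
  refine (norm_sum_le _ _).trans (Finset.sum_le_sum fun α _ => ?_)
  rw [MvPolynomial.aeval_monomial, norm_mul, Finsupp.prod_fintype _ _ (by simp), norm_prod]
  have h1 : ‖(algebraMap ℝ ℂ) (√((α : Fin n →₀ ℕ).multinomial : ℝ) * c α)‖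
      = |√((α : Fin n →₀ ℕ).multinomial : ℝ) * c α| := by
    rw [norm_algebraMap', Real.norm_eq_abs]
  rw [h1, mul_assoc]
  refine mul_le_mul_of_nonneg_left ?_ (abs_nonneg _)
  calc ∏ j, ‖z j ^ (α : Fin n →₀ ℕ) j‖ ≤ ∏ j, (s * r j) ^ (α : Fin n →₀ ℕ) j := by
        refine Finset.prod_le_prod (fun j _ => norm_nonneg _) fun j _ => ?_
        rw [norm_pow]
        exact pow_le_pow_left₀ (norm_nonneg _) (hz j) _
    _ = _ := by
        simp only [mul_pow, Finset.prod_mul_distrib, Finset.prod_pow_eq_pow_sum, sum_multiIndex]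
        ring

lemma norm_cos_le_exp (ζ : ℂ) : ‖Complex.cos ζ‖ ≤ Real.exp |ζ.im| := by
  have h1 : ‖Complex.exp (ζ * Complex.I)‖ ≤ Real.exp |ζ.im| := by
    rw [Complex.norm_exp]; simpa using neg_le_abs ζ.im
  have h2 : ‖Complex.exp (-ζ * Complex.I)‖ ≤ Real.exp |ζ.im| := by
    rw [Complex.norm_exp]; simpa using le_abs_self ζ.im
  rw [Complex.cos, norm_div]
  have := norm_add_le (Complex.exp (ζ * Complex.I)) (Complex.exp (-ζ * Complex.I))
  simp only [Complex.norm_ofNat]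
  linarith

lemma norm_sin_le_exp (ζ : ℂ) : ‖Complex.sin ζ‖ ≤ Real.exp |ζ.im| := by
  have h1 : ‖Complex.exp (ζ * Complex.I)‖ ≤ Real.exp |ζ.im| := by
    rw [Complex.norm_exp]; simpa using neg_le_abs ζ.im
  have h2 : ‖Complex.exp (-ζ * Complex.I)‖ ≤ Real.exp |ζ.im| := by
    rw [Complex.norm_exp]; simpa using le_abs_self ζ.im
  rw [Complex.sin, norm_div, norm_mul, Complex.norm_I]
  have := norm_sub_le (Complex.exp (-ζ * Complex.I)) (Complex.exp (ζ * Complex.I))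
  simp only [Complex.norm_ofNat]
  linarith

end Forms

/-! ### Bernstein inequalities for systems along great circles. -/

section Systems

variable {n m : ℕ} {deg : Fin m → ℕ}

/-- The coefficient vectors of a system of forms of degrees `deg`. -/
abbrev Coeffs (n : ℕ) {m : ℕ} (deg : Fin m → ℕ) : Type :=
  (i : Fin m) → EuclideanSpace ℝ (MultiIndex n (deg i))

/-- The system of forms with given coefficient vectors. -/
noncomputable abbrev forms (c : Coeffs n deg) : Fin m → MvPolynomial (Fin n) ℝ :=
  fun i => formOfCoeffs (c i)

/-- The directional derivative `DP(x) y`. -/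
noncomputable def dirDeriv (P : Fin m → MvPolynomial (Fin n) ℝ) (x y : EuclideanSpace ℝ (Fin n)) :
    EuclideanSpace ℝ (Fin m) :=
  WithLp.toLp 2 fun i => ∑ j, MvPolynomial.eval (fun l => x l) (MvPolynomial.pderiv j (P i)) * y j

lemma evalSystem_forms_apply (c : Coeffs n deg) (x : EuclideanSpace ℝ (Fin n)) (i : Fin m) :
    evalSystem (forms c) x i = inner ℝ (feat (deg i) x) (c i) :=
  eval_formOfCoeffs _ _

lemma norm_le_of_forall_inner_le {E : Type*} [NormedAddCommGroup E] [InnerProductSpace ℝ E]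
    {v : E} {B : ℝ} (hB : 0 ≤ B) (h : ∀ u : E, ‖u‖ = 1 → |inner ℝ u v| ≤ B) : ‖v‖ ≤ B := by
  by_cases hv : v = 0
  · simpa [hv] using hB
  · have hn : ‖v‖ ≠ 0 := norm_ne_zero_iff.2 hv
    have := h (‖v‖⁻¹ • v) (by rw [norm_smul, norm_inv, norm_norm, inv_mul_cancel₀ hn])
    rw [inner_smul_left, real_inner_self_eq_norm_sq] at this
    have e : (starRingEnd ℝ) ‖v‖⁻¹ * ‖v‖ ^ 2 = ‖v‖ := by
      simp only [conj_trivial]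
      field_simp
    rw [e] at this
    exact (le_abs_self _).trans this

lemma norm_cos_smul_add_sin_smul {E : Type*} [NormedAddCommGroup E] [InnerProductSpace ℝ E]
    {x y : E} (hx : ‖x‖ = 1) (hy : ‖y‖ = 1) (hxy : inner ℝ x y = 0) (t : ℝ) :
    ‖Real.cos t • x + Real.sin t • y‖ = 1 := by
  have h : ‖Real.cos t • x + Real.sin t • y‖ ^ 2 = 1 := by
    rw [norm_add_sq_real, inner_smul_left, inner_smul_right, hxy, norm_smul, norm_smul, hx, hy]
    simp [Real.cos_sq_add_sin_sq]
  nlinarith [norm_nonneg (Real.cos t • x + Real.sin t • y)]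

/-- Bernstein-type inequalities along great circles for systems of forms. -/
lemma bernstein_forms (c : Coeffs n deg) {d : ℕ} (hd : 1 ≤ d) (hdeg : ∀ i, deg i ≤ d) {Γ : ℝ}
    (hΓ : ∀ v : EuclideanSpace ℝ (Fin n), ‖v‖ = 1 → ‖evalSystem (forms c) v‖ ≤ Γ)
    {x y : EuclideanSpace ℝ (Fin n)} (hx : ‖x‖ = 1) (hy : ‖y‖ = 1) (hxy : inner ℝ x y = 0)
    (t : ℝ) :
    ‖dirDeriv (forms c) x y‖ ≤ 3 * d * Γ ∧
    ‖evalSystem (forms c) (Real.cos t • x + Real.sin t • y) - evalSystem (forms c) x‖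
      ≤ 3 * d * Γ * |t| ∧
    ‖evalSystem (forms c) (Real.cos t • x + Real.sin t • y) - evalSystem (forms c) x
      - t • dirDeriv (forms c) x y‖ ≤ 9 * d ^ 2 * Γ * t ^ 2 := by
  have hd0 : (0 : ℝ) < d := by exact_mod_cast hd
  have hΓ0 : 0 ≤ Γ := (norm_nonneg _).trans (hΓ x hx)
  let g : Fin n → ℂ → ℂ := fun j ζ => Complex.cos ζ * x j + Complex.sin ζ * y j
  let φ : Fin m → ℂ → ℂ := fun i ζ => MvPolynomial.aeval (fun j => g j ζ) (forms c i)
  have hg : ∀ ζ j, HasDerivAt (g j) (-Complex.sin ζ * x j + Complex.cos ζ * y j) ζ := fun ζ j =>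
    ((Complex.hasDerivAt_cos ζ).mul_const _).add ((Complex.hasDerivAt_sin ζ).mul_const _)
  have hφ : ∀ i ζ, HasDerivAt (φ i) _ ζ := fun i ζ => hasDerivAt_aeval (forms c i) (hg ζ)
  have hreal : ∀ i (s : ℝ), φ i s
      = ((evalSystem (forms c) (Real.cos s • x + Real.sin s • y) i : ℝ) : ℂ) := by
    intro i s
    have := aeval_ofReal (forms c i) (fun j => (Real.cos s • x + Real.sin s • y) j)
    rw [evalSystem, ← this]
    simp [φ, g]
  have hzero : ∀ i, φ i 0 = ((evalSystem (forms c) x i : ℝ) : ℂ) := by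
    intro i
    have := hreal i 0
    simpa using this
  have hder : ∀ i, deriv (φ i) 0 = ((dirDeriv (forms c) x y i : ℝ) : ℂ) := by
    intro i
    rw [(hφ i 0).deriv, dirDeriv]
    push_cast
    refine Finset.sum_congr rfl fun j _ => ?_
    rw [← aeval_ofReal]
    simp [g]
  -- Only finiteness of `A` matters: Phragmén–Lindelöf replaces it by `Γ`.
  obtain ⟨A, hA0, hA⟩ : ∃ A : ℝ, 0 ≤ A ∧ ∀ i ζ, ‖φ i ζ‖ ≤ A * Real.exp (d * |ζ.im|) := by
    let a : Fin m → ℝ := fun i =>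
      ∑ α : MultiIndex n (deg i), |√((α : Fin n →₀ ℕ).multinomial : ℝ) * c i α| *
        ∏ j, (|x j| + |y j|) ^ (α : Fin n →₀ ℕ) j
    have ha : ∀ i, 0 ≤ a i := fun i => by positivity
    refine ⟨∑ i, a i, Finset.sum_nonneg fun i _ => ha i, fun i ζ => ?_⟩
    have h := norm_aeval_formOfCoeffs_le (c i) (fun j => g j ζ) (fun j => |x j| + |y j|)
      (Real.exp |ζ.im|) (fun j => by
        refine (norm_add_le _ _).trans ?_
        rw [norm_mul, norm_mul, Complex.norm_real, Complex.norm_real, mul_add]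
        exact add_le_add (mul_le_mul_of_nonneg_right (norm_cos_le_exp ζ) (abs_nonneg _))
          (mul_le_mul_of_nonneg_right (norm_sin_le_exp ζ) (abs_nonneg _)))
    refine h.trans (mul_le_mul (Finset.single_le_sum (f := a) (fun i _ => ha i)
      (Finset.mem_univ i)) ?_ (by positivity) (Finset.sum_nonneg fun i _ => ha i))
    rw [← Real.exp_nat_mul]
    have : (deg i : ℝ) ≤ d := by exact_mod_cast hdeg i
    gcongr
  -- The vector inequalities are tested against unit vectors `u`, so that the scalar lemma applies
  -- to one entire function at a time with no loss in `m`.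
  have key : ∀ u : EuclideanSpace ℝ (Fin m), ‖u‖ = 1 →
      |inner ℝ u (dirDeriv (forms c) x y)| ≤ 3 * d * Γ ∧
      |inner ℝ u (evalSystem (forms c) (Real.cos t • x + Real.sin t • y) -
        evalSystem (forms c) x)| ≤ 3 * d * Γ * |t| ∧
      |inner ℝ u (evalSystem (forms c) (Real.cos t • x + Real.sin t • y) -
        evalSystem (forms c) x - t • dirDeriv (forms c) x y)| ≤ 9 * d ^ 2 * Γ * t ^ 2 := by
    intro u hu
    let f : ℂ → ℂ := fun ζ => ∑ i, (u i : ℂ) * φ i ζ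
    have hfd : ∀ ζ, HasDerivAt f (∑ i, (u i : ℂ) * deriv (φ i) ζ) ζ := fun ζ =>
      HasDerivAt.fun_sum fun i _ => (hφ i ζ).differentiableAt.hasDerivAt.const_mul _
    have hin : ∀ v : EuclideanSpace ℝ (Fin m),
        ((inner ℝ u v : ℝ) : ℂ) = ∑ i, (u i : ℂ) * (v i : ℂ) := by
      intro v
      rw [PiLp.inner_apply]
      push_cast
      refine Finset.sum_congr rfl fun i _ => ?_
      simp [mul_comm]
    have hfreal : ∀ s : ℝ, f s = ((inner ℝ u
        (evalSystem (forms c) (Real.cos s • x + Real.sin s • y)) : ℝ) : ℂ) := by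
      intro s
      rw [hin]
      exact Finset.sum_congr rfl fun i _ => by rw [hreal]
    have hf0 : f 0 = ((inner ℝ u (evalSystem (forms c) x) : ℝ) : ℂ) := by
      rw [hin]
      exact Finset.sum_congr rfl fun i _ => by rw [hzero]
    have hf1 : deriv f 0 = ((inner ℝ u (dirDeriv (forms c) x y) : ℝ) : ℂ) := by
      rw [(hfd 0).deriv, hin]
      exact Finset.sum_congr rfl fun i _ => by rw [hder]
    have hT := taylor_of_exponentialType (f := f) (A := (∑ i, |u i|) * A) (Γ := Γ) hd0
      (fun ζ => (hfd ζ).differentiableAt)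
      (fun ζ => by
        refine (norm_sum_le _ _).trans ?_
        rw [mul_assoc, Finset.sum_mul]
        refine Finset.sum_le_sum fun i _ => ?_
        rw [norm_mul, Complex.norm_real, Real.norm_eq_abs]
        exact mul_le_mul_of_nonneg_left (hA i ζ) (abs_nonneg _))
      (fun s => by
        rw [hfreal, Complex.norm_real, Real.norm_eq_abs]
        refine (abs_real_inner_le_norm _ _).trans ?_
        rw [hu, one_mul]
        exact hΓ _ (norm_cos_smul_add_sin_smul hx hy hxy s))
    obtain ⟨-, h2, h3⟩ := hT t
    have h1 := (hT 0).1
    rw [Complex.ofReal_zero, hf1, Complex.norm_real, Real.norm_eq_abs] at h1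
    rw [hfreal, hf0, ← Complex.ofReal_sub, Complex.norm_real, Real.norm_eq_abs] at h2
    rw [hfreal, hf0, hf1, ← Complex.ofReal_sub, ← Complex.ofReal_mul, ← Complex.ofReal_sub,
      Complex.norm_real, Real.norm_eq_abs] at h3
    refine ⟨h1, ?_, ?_⟩
    · rwa [inner_sub_right]
    · rwa [inner_sub_right, inner_sub_right, inner_smul_right]
  exact ⟨norm_le_of_forall_inner_le (by positivity) fun u hu => (key u hu).1,
    norm_le_of_forall_inner_le (by positivity) fun u hu => (key u hu).2.1,
    norm_le_of_forall_inner_le (by positivity) fun u hu => (key u hu).2.2⟩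

end Systems

/-! ### Perturbing a point and projecting it back to the sphere. -/

section Normalization

variable {n m : ℕ} {deg : Fin m → ℕ}

lemma abs_arctan_le (b : ℝ) : |Real.arctan b| ≤ |b| := by
  have h : ∀ s : ℝ, 0 ≤ s → |Real.arctan s| ≤ |s| := by
    intro s hs
    have h0 : 0 ≤ Real.arctan s := Real.arctan_nonneg.2 hs
    rw [abs_of_nonneg h0, abs_of_nonneg hs]
    calc Real.arctan s ≤ Real.tan (Real.arctan s) := Real.le_tan h0 (Real.arctan_lt_pi_div_two s)
      _ = s := Real.tan_arctan s
  rcases le_total 0 b with hb | hb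
  · exact h b hb
  · have := h (-b) (by linarith)
    rwa [Real.arctan_neg, abs_neg, abs_neg] at this

/-- The point `x + b y` sits at angle `arctan b` from `x`, so its projection lies on the great
circle where the Bernstein bounds hold. -/
lemma normalize_add_smul {E : Type*} [NormedAddCommGroup E] [InnerProductSpace ℝ E] {x y : E}
    (hx : ‖x‖ = 1) (hy : ‖y‖ = 1) (hxy : inner ℝ x y = 0) (b : ℝ) :
    1 ≤ ‖x + b • y‖ ∧ ‖x + b • y‖⁻¹ • (x + b • y)
      = Real.cos (Real.arctan b) • x + Real.sin (Real.arctan b) • y := by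
  have h : ‖x + b • y‖ = √(1 + b ^ 2) := by
    rw [eq_comm, Real.sqrt_eq_iff_mul_self_eq (by positivity) (norm_nonneg _), ← sq,
      norm_add_sq_real, inner_smul_right, hxy, norm_smul, hx, hy]
    simp
  refine ⟨?_, ?_⟩
  · rw [h]
    exact Real.one_le_sqrt.2 (by nlinarith [sq_nonneg b])
  · rw [h, Real.cos_arctan, Real.sin_arctan, smul_add, smul_smul, one_div, div_eq_inv_mul]

lemma normalize_smul {E : Type*} [NormedAddCommGroup E] [NormedSpace ℝ E] {a : ℝ} (ha : 0 < a)
    (w : E) : ‖a • w‖⁻¹ • (a • w) = ‖w‖⁻¹ • w := by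
  rw [norm_smul, Real.norm_of_nonneg ha.le, smul_smul]
  congr 1
  field_simp

/-- The value of a system at the radial projection of a point to the unit sphere. -/
noncomputable def sphereEval (c : Coeffs n deg) (w : EuclideanSpace ℝ (Fin n)) :
    EuclideanSpace ℝ (Fin m) :=
  evalSystem (forms c) (‖w‖⁻¹ • w)

lemma sphereEval_smul (c : Coeffs n deg) {a : ℝ} (ha : 0 < a) (w : EuclideanSpace ℝ (Fin n)) :
    sphereEval c (a • w) = sphereEval c w := by
  rw [sphereEval, normalize_smul ha, sphereEval]

lemma norm_sphereEval_add_sub_le (c : Coeffs n deg) {d : ℕ} (hd : 1 ≤ d)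
    (hdeg : ∀ i, deg i ≤ d) {Γ : ℝ}
    (hΓ : ∀ v : EuclideanSpace ℝ (Fin n), ‖v‖ = 1 → ‖evalSystem (forms c) v‖ ≤ Γ)
    {x v : EuclideanSpace ℝ (Fin n)} (hx : ‖x‖ = 1) (hv : inner ℝ x v = 0) :
    ‖sphereEval c (x + v) - evalSystem (forms c) x‖ ≤ 3 * d * Γ * ‖v‖ := by
  have hΓ0 : 0 ≤ Γ := (norm_nonneg _).trans (hΓ x hx)
  by_cases h0 : v = 0
  · simp [h0, sphereEval, hx]
  · have hn : ‖v‖ ≠ 0 := norm_ne_zero_iff.2 h0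
    have hy : ‖(‖v‖⁻¹ • v)‖ = 1 := by rw [norm_smul, norm_inv, norm_norm, inv_mul_cancel₀ hn]
    have hxy : inner ℝ x (‖v‖⁻¹ • v) = 0 := by rw [inner_smul_right, hv, mul_zero]
    have e : v = ‖v‖ • (‖v‖⁻¹ • v) := by rw [smul_smul, mul_inv_cancel₀ hn, one_smul]
    rw [sphereEval]
    conv_lhs => rw [e]
    rw [(normalize_add_smul hx hy hxy _).2]
    refine (bernstein_forms c hd hdeg hΓ hx hy hxy _).2.1.trans ?_
    have := abs_arctan_le ‖v‖
    rw [abs_norm] at this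
    gcongr

/-- Move in two stages: first along the great circle towards `y`, with a second-order Taylor bound
that sees the directional derivative; then by `z`, orthogonal to that circle, with only the
Lipschitz bound. This anisotropy allows the box to be wider along `y`. -/
lemma norm_sphereEval_le (c : Coeffs n deg) {d : ℕ} (hd : 1 ≤ d)
    (hdeg : ∀ i, deg i ≤ d) {Γ : ℝ}
    (hΓ : ∀ v : EuclideanSpace ℝ (Fin n), ‖v‖ = 1 → ‖evalSystem (forms c) v‖ ≤ Γ)
    {x y z : EuclideanSpace ℝ (Fin n)} (hx : ‖x‖ = 1) (hy : ‖y‖ = 1) (hxy : inner ℝ x y = 0)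
    (hxz : inner ℝ x z = 0) (hyz : inner ℝ y z = 0) (b : ℝ) :
    ‖sphereEval c (x + b • y + z)‖ ≤ ‖evalSystem (forms c) x‖ +
      |b| * ‖dirDeriv (forms c) x y‖ + 9 * d ^ 2 * Γ * b ^ 2 + 3 * d * Γ * ‖z‖ := by
  have hΓ0 : 0 ≤ Γ := (norm_nonneg _).trans (hΓ x hx)
  obtain ⟨hr, hnorm⟩ := normalize_add_smul hx hy hxy b
  set r := ‖x + b • y‖ with hrdef
  have hr0 : 0 < r := by linarith
  set x₁ := Real.cos (Real.arctan b) • x + Real.sin (Real.arctan b) • y with hx₁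
  have hx1 : ‖x₁‖ = 1 := norm_cos_smul_add_sin_smul hx hy hxy _
  have hx1z : inner ℝ x₁ (r⁻¹ • z) = 0 := by
    rw [inner_smul_right, hx₁, inner_add_left, inner_smul_left, inner_smul_left, hxz, hyz]
    simp
  have e : x + b • y + z = r • (x₁ + r⁻¹ • z) := by
    rw [← hnorm, smul_add, smul_smul, smul_smul, mul_inv_cancel₀ hr0.ne', one_smul, one_smul]
  rw [e, sphereEval_smul c hr0]
  have h1 := norm_sphereEval_add_sub_le c hd hdeg hΓ hx1 hx1z
  have h2 := (bernstein_forms c hd hdeg hΓ hx hy hxy (Real.arctan b)).2.2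
  have h3 : ‖r⁻¹ • z‖ ≤ ‖z‖ := by
    rw [norm_smul, norm_inv, Real.norm_of_nonneg hr0.le]
    exact mul_le_of_le_one_left (norm_nonneg _) (inv_le_one_of_one_le₀ hr)
  have hab := abs_arctan_le b
  have h4 : Real.arctan b ^ 2 ≤ b ^ 2 := sq_le_sq.2 hab
  have h5 : ‖evalSystem (forms c) x₁‖ ≤ ‖evalSystem (forms c) x‖ +
      |b| * ‖dirDeriv (forms c) x y‖ + 9 * d ^ 2 * Γ * b ^ 2 := by
    have : evalSystem (forms c) x₁ = (evalSystem (forms c) x₁ - evalSystem (forms c) x -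
        Real.arctan b • dirDeriv (forms c) x y) + evalSystem (forms c) x +
        Real.arctan b • dirDeriv (forms c) x y := by abel
    rw [this]
    refine (norm_add₃_le).trans ?_
    rw [norm_smul, Real.norm_eq_abs]
    have h6 : |Real.arctan b| * ‖dirDeriv (forms c) x y‖ ≤ |b| * ‖dirDeriv (forms c) x y‖ := by
      gcongr
    have h7 : 9 * (d : ℝ) ^ 2 * Γ * Real.arctan b ^ 2 ≤ 9 * d ^ 2 * Γ * b ^ 2 := by gcongr
    linarith
  have h8 : 3 * (d : ℝ) * Γ * ‖r⁻¹ • z‖ ≤ 3 * d * Γ * ‖z‖ := by gcongr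
  have h9 := norm_sub_norm_le (sphereEval c (x₁ + r⁻¹ • z)) (evalSystem (forms c) x₁)
  linarith

end Normalization

/-! ### Boxes around orthonormal pairs and their volume. -/

section Box

lemma lintegral_gaussian {V : Type*} [NormedAddCommGroup V] [InnerProductSpace ℝ V]
    [FiniteDimensional ℝ V] [MeasurableSpace V] [BorelSpace V] {b : ℝ} (hb : 0 < b) :
    ∫⁻ v : V, ENNReal.ofReal (Real.exp (-b * ‖v‖ ^ 2))
      = ENNReal.ofReal (√(Real.pi / b) ^ Module.finrank ℝ V) := by
  have hint := GaussianFourier.integral_rexp_neg_mul_sq_norm (V := V) hb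
  have hpos : (0 : ℝ) < (Real.pi / b) ^ (Module.finrank ℝ V / 2 : ℝ) :=
    Real.rpow_pos_of_pos (by positivity) _
  rw [← ofReal_integral_eq_lintegral_ofReal, hint]
  · congr 1
    rw [Real.sqrt_eq_rpow, ← Real.rpow_natCast, ← Real.rpow_mul (by positivity)]
    congr 1
    ring
  · by_contra h
    rw [integral_undef h] at hint
    linarith
  · exact Filter.Eventually.of_forall fun v => (Real.exp_pos _).le

/-- On the ball `exp (4n - n ‖v‖²) ≥ 1`, so a Gaussian integral bounds the volume with the right
order `n^(-n/2)` and no Gamma function. -/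
lemma volume_ball_two_le {n : ℕ} (hn : 0 < n) :
    volume (Metric.ball (0 : EuclideanSpace ℝ (Fin n)) 2)
      ≤ ENNReal.ofReal (Real.exp (4 * n) * √(Real.pi / n) ^ n) := by
  have hn0 : (0 : ℝ) < n := by exact_mod_cast hn
  have h := lintegral_gaussian (V := EuclideanSpace ℝ (Fin n)) hn0
  rw [finrank_euclideanSpace_fin] at h
  rw [ENNReal.ofReal_mul (Real.exp_pos _).le, ← h,
    ← lintegral_const_mul' _ _ ENNReal.ofReal_ne_top]
  calc volume (Metric.ball (0 : EuclideanSpace ℝ (Fin n)) 2)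
      = ∫⁻ _ in Metric.ball (0 : EuclideanSpace ℝ (Fin n)) 2, 1 := by simp
    _ ≤ ∫⁻ v in Metric.ball (0 : EuclideanSpace ℝ (Fin n)) 2,
          ENNReal.ofReal (Real.exp (4 * n)) * ENNReal.ofReal (Real.exp (-n * ‖v‖ ^ 2)) := by
        refine setLIntegral_mono' measurableSet_ball fun v hv => ?_
        rw [← ENNReal.ofReal_mul (Real.exp_pos _).le, ← Real.exp_add, ← ENNReal.ofReal_one]
        apply ENNReal.ofReal_le_ofReal
        apply Real.one_le_exp
        have : ‖v‖ < 2 := by simpa using hv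
        nlinarith [norm_nonneg v, mul_nonneg hn0.le (show 0 ≤ 4 - ‖v‖ ^ 2 by nlinarith [norm_nonneg v])]
    _ ≤ _ := setLIntegral_le_lintegral _ _

/-- Around every orthonormal pair `x, y` there is a box that is thick in the radial direction, has
width `β₁` in the direction `y` and radius `β₂` in the remaining directions, whose volume is not
much smaller than `β₁ β₂ ^ k`, relatively to the volume of a ball. -/
lemma exists_box {k : ℕ} {x y : EuclideanSpace ℝ (Fin (k + 2))} (hx : ‖x‖ = 1) (hy : ‖y‖ = 1)
    (hxy : inner ℝ x y = 0) {β₁ β₂ : ℝ} (h1 : 0 < β₁) (h1' : β₁ ≤ 1) (h2 : 0 < β₂) (h2' : β₂ ≤ 1) :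
    ∃ B : Set (EuclideanSpace ℝ (Fin (k + 2))), MeasurableSet B ∧ B ⊆ Metric.ball 0 2 ∧
      (∀ w ∈ B, ∃ (a b : ℝ) (z : EuclideanSpace ℝ (Fin (k + 2))), 0 < a ∧
        w = a • (x + b • y + z) ∧ |b| ≤ β₁ ∧ ‖z‖ ≤ β₂ ∧ inner ℝ x z = 0 ∧ inner ℝ y z = 0) ∧
      volume (Metric.ball (0 : EuclideanSpace ℝ (Fin (k + 2))) 2)
        ≤ ENNReal.ofReal (Real.exp 6 ^ (k + 2) / (β₁ * β₂ ^ k)) * volume B := by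
  obtain ⟨ν, hν⟩ : ∃ ν : ℝ, ν = ((k + 2 : ℕ) : ℝ) := ⟨_, rfl⟩
  have hkν : (k : ℝ) + 2 = ν := by rw [hν]; push_cast; ring
  have hk0 : (0 : ℝ) ≤ k := Nat.cast_nonneg k
  have hn0 : 0 < ν := by linarith
  have hn2 : 2 ≤ ν := by linarith
  obtain ⟨e, he⟩ : ∃ e : OrthonormalBasis (Fin (k + 2)) ℝ (EuclideanSpace ℝ (Fin (k + 2))),
      e 0 = x ∧ e 1 = y := by
    have hv : Orthonormal ℝ (({0, 1} : Set (Fin (k + 2))).domRestrict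
        (fun i : Fin (k + 2) => if i = 0 then x else y)) := by
      refine ⟨?_, ?_⟩
      · rintro ⟨i, hi⟩
        simp only [Set.domRestrict_apply]
        split_ifs <;> assumption
      · rintro ⟨i, hi⟩ ⟨j, hj⟩ hij
        have hij' : i ≠ j := fun h => hij (Subtype.ext h)
        simp only [Set.domRestrict_apply]
        rcases hi with rfl | hi <;> rcases hj with rfl | hj
        · exact absurd rfl hij'
        · simp only [Set.mem_singleton_iff] at hj
          subst hj
          simpa using hxy
        · simp only [Set.mem_singleton_iff] at hi
          subst hi
          simpa [real_inner_comm] using hxy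
        · simp only [Set.mem_singleton_iff] at hi hj
          exact absurd (hi.trans hj.symm) hij'
    obtain ⟨e, he⟩ := hv.exists_orthonormalBasis_extension_of_card_eq (by simp)
    exact ⟨e, by simpa using he 0 (by simp), by simpa using he 1 (by simp)⟩
  -- The last `k` coordinates range over a cube of half-side `r`, which lies in a ball of radius `β₂
  -- / 2`. The factor `√ν ^ k` lost in volume matches the one in the volume of the ambient ball.
  set r : ℝ := β₂ / (2 * √ν) with hr
  have hsn : 0 < √ν := Real.sqrt_pos.2 hn0
  have hsq : √ν ^ 2 = ν := Real.sq_sqrt hn0.le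
  have hr0 : 0 < r := by positivity
  -- The radial coordinate stays in `[1/2, 1]`, so dividing by it at most doubles the others. Hence
  -- the half-widths `β₁ / 2` and `β₂ / 2`.
  let lo : Fin (k + 2) → ℝ := Fin.cons (1 / 2) (Fin.cons (-(β₁ / 2)) fun _ : Fin k => -r)
  let hi : Fin (k + 2) → ℝ := Fin.cons 1 (Fin.cons (β₁ / 2) fun _ : Fin k => r)
  let φ : EuclideanSpace ℝ (Fin (k + 2)) → (Fin (k + 2) → ℝ) := fun w => WithLp.ofLp (e.repr w)
  have hφ : MeasurePreserving φ volume volume :=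
    (PiLp.volume_preserving_ofLp (Fin (k + 2))).comp e.measurePreserving_repr
  have hvol : volume (φ ⁻¹' Set.Icc lo hi) = ENNReal.ofReal (1 / 2 * β₁ * (2 * r) ^ k) := by
    rw [hφ.measure_preimage measurableSet_Icc.nullMeasurableSet, Real.volume_Icc_pi,
      ← ENNReal.ofReal_prod_of_nonneg]
    · congr 1
      rw [Fin.prod_univ_succ, Fin.prod_univ_succ]
      simp only [lo, hi, Fin.cons_zero, Fin.cons_succ, Finset.prod_const, Finset.card_univ,
        Fintype.card_fin]
      ring
    · intro i _
      refine Fin.cases ?_ (fun i => Fin.cases ?_ (fun i => ?_) i) i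
      · simp only [lo, hi, Fin.cons_zero]; norm_num
      · simp only [lo, hi, Fin.cons_succ, Fin.cons_zero]; linarith
      · simp only [lo, hi, Fin.cons_succ]; linarith
  have hmem : ∀ w ∈ φ ⁻¹' Set.Icc lo hi, (1 / 2 ≤ e.repr w 0 ∧ e.repr w 0 ≤ 1) ∧
      |e.repr w 1| ≤ β₁ / 2 ∧ ∀ j : Fin k, |e.repr w j.succ.succ| ≤ r := by
    intro w hw
    obtain ⟨hl, hh⟩ := hw
    refine ⟨⟨by simpa [lo] using hl 0, by simpa [hi] using hh 0⟩,
      abs_le.2 ⟨?_, ?_⟩, fun j => abs_le.2 ⟨?_, ?_⟩⟩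
    · exact hl (Fin.succ 0)
    · exact hh (Fin.succ 0)
    · exact hl j.succ.succ
    · exact hh j.succ.succ
  have hrest : ∀ w ∈ φ ⁻¹' Set.Icc lo hi,
      ∑ j : Fin k, (e.repr w j.succ.succ) ^ 2 ≤ (β₂ / 2) ^ 2 := by
    intro w hw
    calc ∑ j : Fin k, (e.repr w j.succ.succ) ^ 2 ≤ ∑ _j : Fin k, r ^ 2 :=
          Finset.sum_le_sum fun j _ => sq_le_sq' (abs_le.1 ((hmem w hw).2.2 j)).1
            (abs_le.1 ((hmem w hw).2.2 j)).2
      _ = k * r ^ 2 := by simp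
      _ ≤ ν * r ^ 2 := by
          have : (k : ℝ) ≤ ν := by linarith
          gcongr
      _ = (β₂ / 2) ^ 2 := by
          rw [hr, div_pow, mul_pow, hsq]
          field_simp
  refine ⟨φ ⁻¹' Set.Icc lo hi, hφ.measurable measurableSet_Icc, ?_, ?_, ?_⟩
  · intro w hw
    rw [mem_ball_zero_iff]
    obtain ⟨h3, h4, -⟩ := hmem w hw
    have h5 := hrest w hw
    have h6 : ‖w‖ ^ 2 = (e.repr w 0) ^ 2 + ((e.repr w 1) ^ 2 +
        ∑ j : Fin k, (e.repr w j.succ.succ) ^ 2) := by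
      rw [← e.repr.norm_map, EuclideanSpace.real_norm_sq_eq, Fin.sum_univ_succ,
        Fin.sum_univ_succ]
      rfl
    have h7 : (e.repr w 1) ^ 2 ≤ (β₁ / 2) ^ 2 := sq_le_sq' (abs_le.1 h4).1 (abs_le.1 h4).2
    by_contra! h8
    nlinarith
  · intro w hw
    obtain ⟨h3, h4, -⟩ := hmem w hw
    have h5 := hrest w hw
    set a := e.repr w 0
    have ha : 0 < a := by linarith [h3.1]
    set z₀ : EuclideanSpace ℝ (Fin (k + 2)) := ∑ j : Fin k, e.repr w j.succ.succ • e j.succ.succ with hz₀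
    have hw' : w = a • x + (e.repr w 1 • y + z₀) := by
      conv_lhs => rw [← e.sum_repr w]
      rw [Fin.sum_univ_succ, Fin.sum_univ_succ, he.1]
      congr 2
      rw [← he.2]
      rfl
    have hzn : ‖z₀‖ ≤ β₂ / 2 := by
      have : ‖z₀‖ ^ 2 = ∑ j : Fin k, (e.repr w j.succ.succ) ^ 2 := by
        have ho : Orthonormal ℝ (fun j : Fin k => e j.succ.succ) :=
          e.orthonormal.comp _ ((Fin.succ_injective _).comp (Fin.succ_injective _))
        rw [← real_inner_self_eq_norm_sq, hz₀, ho.inner_sum]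
        refine Finset.sum_congr rfl fun j _ => ?_
        simp [sq]
      rw [← this] at h5
      exact le_of_sq_le_sq h5 (by positivity)
    have hxz : ∀ i : Fin (k + 2), (∀ j : Fin k, i ≠ j.succ.succ) → inner ℝ (e i) z₀ = 0 := by
      intro i hij
      rw [hz₀, inner_sum]
      refine Finset.sum_eq_zero fun j _ => ?_
      rw [inner_smul_right, e.orthonormal.2 (hij j), mul_zero]
    refine ⟨a, e.repr w 1 / a, a⁻¹ • z₀, ha, ?_, ?_, ?_, ?_, ?_⟩
    · rw [smul_add, smul_add, smul_smul, smul_smul, mul_inv_cancel₀ ha.ne', one_smul,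
        mul_div_cancel₀ _ ha.ne', add_assoc]
      exact hw'
    · rw [abs_div, abs_of_pos ha, div_le_iff₀ ha]
      nlinarith [h3.1]
    · rw [norm_smul, norm_inv, Real.norm_of_nonneg ha.le, inv_mul_le_iff₀ ha]
      nlinarith [h3.1]
    · rw [inner_smul_right, ← he.1, hxz 0 (fun j => (Fin.succ_ne_zero _).symm), mul_zero]
    · rw [inner_smul_right, ← he.2, hxz 1 (fun j h => by
        have := congrArg Fin.val h
        simp at this), mul_zero]
  · refine (volume_ball_two_le (by omega : 0 < k + 2)).trans ?_
    rw [hvol, ← hν, ← ENNReal.ofReal_mul (by positivity)]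
    apply ENNReal.ofReal_le_ofReal
    have hpi : √Real.pi ≤ Real.exp 1 := by
      rw [Real.sqrt_le_left (Real.exp_pos _).le]
      nlinarith [Real.pi_lt_d2, Real.exp_one_gt_d9]
    have e1 : Real.exp 6 ^ (k + 2) / (β₁ * β₂ ^ k) * (1 / 2 * β₁ * (2 * r) ^ k)
        = Real.exp 6 ^ (k + 2) / 2 / √ν ^ k := by
      rw [hr]
      have : 2 * (β₂ / (2 * √ν)) = β₂ / √ν := by field_simp
      rw [this, div_pow]
      field_simp
    have e2 : √(Real.pi / ν) ^ (k + 2) = √Real.pi ^ (k + 2) / (√ν ^ k * ν) := by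
      rw [Real.sqrt_div Real.pi_pos.le, div_pow, pow_add √ν, hsq]
    have e3 : Real.exp (4 * ν) = Real.exp 4 ^ (k + 2) := by
      rw [mul_comm, hν, Real.exp_nat_mul]
    rw [e1, e2, e3, div_div, ← mul_div_assoc, div_le_div_iff₀ (by positivity) (by positivity)]
    have e4 : Real.exp 4 ^ (k + 2) * √Real.pi ^ (k + 2) ≤ Real.exp 6 ^ (k + 2) := by
      rw [← mul_pow]
      refine pow_le_pow_left₀ (by positivity) ?_ _
      calc Real.exp 4 * √Real.pi ≤ Real.exp 4 * Real.exp 1 := by gcongr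
        _ = Real.exp 5 := by rw [← Real.exp_add]; norm_num
        _ ≤ Real.exp 6 := Real.exp_le_exp.2 (by norm_num)
    have e5 : (0 : ℝ) < √ν ^ k := by positivity
    calc Real.exp 4 ^ (k + 2) * √Real.pi ^ (k + 2) * (2 * √ν ^ k) ≤ Real.exp 6 ^ (k + 2) * (ν * √ν ^ k) := by
          gcongr
      _ = _ := by ring

end Box

/-! ### Exponential moments from the two assumptions. -/

section ExponentialMoments

variable {Ω : Type*} [MeasurableSpace Ω] {μ : Measure Ω} [IsProbabilityMeasure μ]

lemma lintegral_comp_le_tsum {ν : Measure Ω} {u : Ω → ℝ} (hu : Measurable u) (hu0 : ∀ ω, 0 ≤ u ω)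
    {φ : ℝ → ℝ≥0∞} {b : ℕ → ℝ≥0∞} (hφ : ∀ (k : ℕ) (t : ℝ), k ≤ t → t < k + 1 → φ t ≤ b k) :
    ∫⁻ ω, φ (u ω) ∂ν ≤ ∑' k : ℕ, b k * ν {ω | k ≤ u ω ∧ u ω < k + 1} := by
  have hmeas : ∀ k : ℕ, MeasurableSet {ω | (k : ℝ) ≤ u ω ∧ u ω < k + 1} := fun k =>
    (measurableSet_le measurable_const hu).inter (measurableSet_lt hu measurable_const)
  calc ∫⁻ ω, φ (u ω) ∂ν
      ≤ ∫⁻ ω, ∑' k : ℕ, Set.indicator {ω | (k : ℝ) ≤ u ω ∧ u ω < k + 1} (fun _ => b k) ω ∂ν := by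
        refine lintegral_mono fun ω => ?_
        have h1 := Nat.floor_le (hu0 ω)
        have h2 := Nat.lt_floor_add_one (u ω)
        refine le_trans ?_ (ENNReal.le_tsum ⌊u ω⌋₊)
        refine (hφ _ _ h1 h2).trans (le_of_eq ?_)
        exact (Set.indicator_of_mem (s := {ω' | ((⌊u ω⌋₊ : ℕ) : ℝ) ≤ u ω' ∧ u ω' < ⌊u ω⌋₊ + 1})
          ⟨h1, h2⟩ fun _ => b ⌊u ω⌋₊).symm
    _ = ∑' k : ℕ, b k * ν {ω | (k : ℝ) ≤ u ω ∧ u ω < k + 1} := by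
        rw [lintegral_tsum fun k => (measurable_const.indicator (hmeas k)).aemeasurable]
        exact tsum_congr fun k => lintegral_indicator_const (hmeas k) _

lemma measure_le_ofReal_of_real_le {s : Set Ω} {a : ℝ} (h : μ.real s ≤ a) :
    μ s ≤ ENNReal.ofReal a := by
  rw [← ENNReal.ofReal_toReal (measure_ne_top μ s)]
  exact ENNReal.ofReal_le_ofReal h

lemma tsum_ofReal_geometric {a r : ℝ} (ha : 0 ≤ a) (hr0 : 0 ≤ r) (hr1 : r < 1) :
    ∑' k : ℕ, ENNReal.ofReal (a * r ^ k) = ENNReal.ofReal (a / (1 - r)) := by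
  rw [← ENNReal.ofReal_tsum_of_nonneg (fun k => by positivity)
    ((summable_geometric_of_lt_one hr0 hr1).mul_left a), tsum_mul_left,
    tsum_geometric_of_lt_one hr0 hr1, div_eq_mul_inv]

/-- Cutting into unit layers, layer `k` contributes at most `exp (k + 1) · 2 exp (-2k)`, and `2e /
(1 - 1/e) < 9`. -/
lemma lintegral_exp_sq_le {p : Ω → ℝ} (hp : Measurable p) {K : ℝ} (hK : 0 < K)
    (h : ∀ t : ℝ, 0 < t → μ.real {ω | t ≤ |p ω|} ≤ 2 * Real.exp (-t ^ 2 / K ^ 2)) :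
    ∫⁻ ω, ENNReal.ofReal (Real.exp (p ω ^ 2 / (2 * K ^ 2))) ∂μ ≤ 9 := by
  have h1 := lintegral_comp_le_tsum (ν := μ) (u := fun ω => p ω ^ 2 / (2 * K ^ 2))
    (φ := fun t => ENNReal.ofReal (Real.exp t)) (b := fun k => ENNReal.ofReal (Real.exp (k + 1)))
    (by fun_prop) (fun ω => by positivity)
    (fun k t _ ht => ENNReal.ofReal_le_ofReal (Real.exp_le_exp.2 ht.le))
  refine h1.trans ?_
  have h2 : ∀ k : ℕ, ENNReal.ofReal (Real.exp (k + 1)) *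
      μ {ω | (k : ℝ) ≤ p ω ^ 2 / (2 * K ^ 2) ∧ p ω ^ 2 / (2 * K ^ 2) < k + 1}
      ≤ ENNReal.ofReal (2 * Real.exp 1 * (Real.exp (-1)) ^ k) := by
    intro k
    have h3 : μ {ω | (k : ℝ) ≤ p ω ^ 2 / (2 * K ^ 2) ∧ p ω ^ 2 / (2 * K ^ 2) < k + 1}
        ≤ ENNReal.ofReal (2 * Real.exp (-(2 * k))) := by
      rcases Nat.eq_zero_or_pos k with hk | hk
      · subst hk
        refine prob_le_one.trans ?_
        rw [← ENNReal.ofReal_one]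
        apply ENNReal.ofReal_le_ofReal
        simp
      · have hk0 : (0 : ℝ) < k := by exact_mod_cast hk
        have hs : 0 < √(2 * k : ℝ) := Real.sqrt_pos.2 (by positivity)
        have h4 := measure_le_ofReal_of_real_le (h (√(2 * k) * K) (by positivity))
        have e : -(√(2 * k) * K) ^ 2 / K ^ 2 = -(2 * k : ℝ) := by
          rw [mul_pow, Real.sq_sqrt (by positivity)]
          field_simp
        rw [e] at h4
        refine (measure_mono ?_).trans h4
        rintro ω ⟨hω, -⟩
        rw [le_div_iff₀ (by positivity)] at hω
        change √(2 * k : ℝ) * K ≤ |p ω|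
        refine le_of_sq_le_sq ?_ (abs_nonneg _)
        rw [mul_pow, Real.sq_sqrt (by positivity), sq_abs]
        linarith
    refine (mul_le_mul_right h3 _).trans ?_
    rw [← ENNReal.ofReal_mul (Real.exp_pos _).le]
    apply ENNReal.ofReal_le_ofReal
    rw [← Real.exp_nat_mul, mul_left_comm, mul_assoc, ← Real.exp_add, ← Real.exp_add]
    apply le_of_eq
    congr 2
    ring
  refine (ENNReal.tsum_le_tsum h2).trans ?_
  have he : Real.exp (-1) < 1 := by
    rw [← Real.exp_zero]
    exact Real.exp_lt_exp.2 (by norm_num)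
  rw [tsum_ofReal_geometric (by positivity) (Real.exp_pos _).le he]
  rw [← ENNReal.ofReal_ofNat]
  apply ENNReal.ofReal_le_ofReal
  rw [div_le_iff₀ (by linarith), Real.exp_neg]
  have h5 := Real.exp_one_gt_d9
  have h6 := Real.exp_one_lt_d9
  have h7 : (Real.exp 1)⁻¹ ≤ 0.37 := by
    rw [inv_le_comm₀ (by positivity) (by norm_num)]
    linarith
  linarith

/-- Layer `k` has probability at most `c₀ ε √(k + 1) ≤ c₀ ε exp (k / 2)` and weight `exp (-k)`,
leaving a geometric series of ratio `exp (-1/2) ≤ 2/3`. -/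
lemma lintegral_exp_neg_sq_le {p : Ω → ℝ} (hp : Measurable p) {c₀ ε : ℝ} (hc : 0 < c₀) (hε : 0 < ε)
    (h : ∀ t : ℝ, 0 < t → μ.real {ω | |p ω| ≤ t} ≤ c₀ * t) :
    ∫⁻ ω, ENNReal.ofReal (Real.exp (-(p ω ^ 2 / ε ^ 2))) ∂μ ≤ ENNReal.ofReal (3 * c₀ * ε) := by
  have h1 := lintegral_comp_le_tsum (ν := μ) (u := fun ω => p ω ^ 2 / ε ^ 2)
    (φ := fun t => ENNReal.ofReal (Real.exp (-t))) (b := fun k => ENNReal.ofReal (Real.exp (-k)))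
    (by fun_prop) (fun ω => by positivity)
    (fun k t ht _ => ENNReal.ofReal_le_ofReal (Real.exp_le_exp.2 (neg_le_neg ht)))
  refine h1.trans ?_
  have h2 : ∀ k : ℕ, ENNReal.ofReal (Real.exp (-k)) *
      μ {ω | (k : ℝ) ≤ p ω ^ 2 / ε ^ 2 ∧ p ω ^ 2 / ε ^ 2 < k + 1}
      ≤ ENNReal.ofReal (c₀ * ε * (Real.exp (-(1 / 2))) ^ k) := by
    intro k
    have hk0 : (0 : ℝ) ≤ k := Nat.cast_nonneg k
    have h3 : μ {ω | (k : ℝ) ≤ p ω ^ 2 / ε ^ 2 ∧ p ω ^ 2 / ε ^ 2 < k + 1}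
        ≤ ENNReal.ofReal (c₀ * (Real.exp (k / 2) * ε)) := by
      refine (measure_mono ?_).trans (measure_le_ofReal_of_real_le (h (Real.exp (k / 2) * ε)
        (by positivity)))
      rintro ω ⟨-, hω⟩
      rw [div_lt_iff₀ (by positivity)] at hω
      change |p ω| ≤ Real.exp (k / 2) * ε
      refine abs_le_of_sq_le_sq ?_ (by positivity)
      rw [mul_pow, ← Real.exp_nat_mul]
      have h4 : (k : ℝ) + 1 ≤ Real.exp ((2 : ℕ) * (k / 2 : ℝ)) := by
        have := Real.add_one_le_exp (k : ℝ)
        rwa [show ((2 : ℕ) : ℝ) * (k / 2 : ℝ) = k by push_cast; ring]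
      exact hω.le.trans (by gcongr)
    refine (mul_le_mul_right h3 _).trans ?_
    rw [← ENNReal.ofReal_mul (Real.exp_pos _).le]
    apply ENNReal.ofReal_le_ofReal
    rw [← Real.exp_nat_mul]
    have e : Real.exp (-k) * (c₀ * (Real.exp (k / 2) * ε))
        = c₀ * ε * (Real.exp (-k) * Real.exp (k / 2)) := by ring
    rw [e, ← Real.exp_add]
    apply le_of_eq
    congr 2
    ring
  refine (ENNReal.tsum_le_tsum h2).trans ?_
  have he : Real.exp (-(1 / 2)) ≤ 2 / 3 := by
    have h5 := Real.exp_one_gt_d9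
    have h6 : Real.exp (-(1 / 2)) ^ 2 = (Real.exp 1)⁻¹ := by
      rw [← Real.exp_nat_mul, ← Real.exp_neg]; norm_num
    have h7 : (Real.exp 1)⁻¹ ≤ (2 / 3) ^ 2 := by
      rw [inv_le_comm₀ (by positivity) (by norm_num)]
      norm_num
      linarith
    exact le_of_sq_le_sq (h6 ▸ h7) (by norm_num)
  rw [tsum_ofReal_geometric (by positivity) (Real.exp_pos _).le (by linarith)]
  apply ENNReal.ofReal_le_ofReal
  rw [div_le_iff₀ (by linarith)]
  have : 0 < c₀ * ε := by positivity
  nlinarith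

/-- Gaussian linearization: `exp (‖C‖² / 4K²)` is a normalized Gaussian average over `v` of `exp ⟨C,
v⟩`. After Tonelli only the one-dimensional marginals of `X` are needed, so independence of its
coordinates is not. -/
lemma SubGaussianWith.lintegral_exp_norm_sq_le {ι : Type*} [Fintype ι]
    {X : Ω → EuclideanSpace ℝ ι} (hX : Measurable X) {K : ℝ} (hK : 0 < K)
    (h : SubGaussianWith μ X K) :
    ∫⁻ ω, ENNReal.ofReal (Real.exp (‖X ω‖ ^ 2 / (4 * K ^ 2))) ∂μ
      ≤ ENNReal.ofReal (9 * √2 ^ Fintype.card ι) := by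
  have hK2 : 0 < K ^ 2 := by positivity
  have h1 : ∀ v : EuclideanSpace ℝ ι, ∫⁻ ω, ENNReal.ofReal (Real.exp (inner ℝ (X ω) v)) ∂μ
      ≤ ENNReal.ofReal (Real.exp (K ^ 2 / 2 * ‖v‖ ^ 2)) * 9 := by
    intro v
    by_cases hv : v = 0
    · subst hv
      simp only [inner_zero_right, Real.exp_zero, ENNReal.ofReal_one, lintegral_const,
        measure_univ, norm_zero]
      norm_num
    · have hn : ‖v‖ ≠ 0 := norm_ne_zero_iff.2 hv
      have hθ : ‖(‖v‖⁻¹ • v)‖ = 1 := by rw [norm_smul, norm_inv, norm_norm, inv_mul_cancel₀ hn]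
      have h2 := lintegral_exp_sq_le (μ := μ) (p := fun ω => inner ℝ (X ω) (‖v‖⁻¹ • v))
        (hX.inner measurable_const) hK (h _ hθ)
      refine le_trans ?_ (mul_le_mul_right h2 _)
      rw [← lintegral_const_mul' _ _ ENNReal.ofReal_ne_top]
      refine lintegral_mono fun ω => ?_
      rw [← ENNReal.ofReal_mul (Real.exp_pos _).le, ← Real.exp_add]
      apply ENNReal.ofReal_le_ofReal
      apply Real.exp_le_exp.2
      have e : inner ℝ (X ω) v = ‖v‖ * inner ℝ (X ω) (‖v‖⁻¹ • v) := by
        rw [inner_smul_right, ← mul_assoc, mul_inv_cancel₀ hn, one_mul]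
      rw [e]
      set s := inner ℝ (X ω) (‖v‖⁻¹ • v)
      have h3 : 0 ≤ (s / K - K * ‖v‖) ^ 2 := sq_nonneg _
      have h4 : (s / K - K * ‖v‖) ^ 2 = 2 * (K ^ 2 / 2 * ‖v‖ ^ 2 + s ^ 2 / (2 * K ^ 2))
          - 2 * (‖v‖ * s) := by
        field_simp
        ring
      linarith
  have hcomp : ∀ C : EuclideanSpace ℝ ι,
      ENNReal.ofReal (√(Real.pi / K ^ 2) ^ Fintype.card ι) *
        ENNReal.ofReal (Real.exp (‖C‖ ^ 2 / (4 * K ^ 2)))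
      = ∫⁻ v : EuclideanSpace ℝ ι, ENNReal.ofReal (Real.exp (-K ^ 2 * ‖v‖ ^ 2)) *
          ENNReal.ofReal (Real.exp (inner ℝ C v)) := by
    intro C
    have h2 := lintegral_gaussian (V := EuclideanSpace ℝ ι) hK2
    rw [finrank_euclideanSpace] at h2
    -- Completing the square: the Gaussian is translated by `C / (2K²)`.
    rw [← h2, ← lintegral_mul_const' _ _ ENNReal.ofReal_ne_top,
      ← lintegral_add_right_eq_self _ (-((1 / (2 * K ^ 2)) • C))]
    refine lintegral_congr fun v => ?_
    rw [← ENNReal.ofReal_mul (Real.exp_pos _).le, ← ENNReal.ofReal_mul (Real.exp_pos _).le,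
      ← Real.exp_add, ← Real.exp_add, ← sub_eq_add_neg, norm_sub_sq_real, inner_smul_right,
      norm_smul, real_inner_comm, mul_pow, Real.norm_eq_abs, sq_abs]
    congr 2
    field_simp
    ring
  have hc : ENNReal.ofReal (√(Real.pi / K ^ 2) ^ Fintype.card ι) ≠ 0 := by
    rw [Ne, ENNReal.ofReal_eq_zero, not_le]
    exact pow_pos (Real.sqrt_pos.2 (div_pos Real.pi_pos hK2)) _
  rw [← ENNReal.mul_le_mul_iff_right hc ENNReal.ofReal_ne_top,
    ← lintegral_const_mul' _ _ ENNReal.ofReal_ne_top]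
  calc ∫⁻ ω, ENNReal.ofReal (√(Real.pi / K ^ 2) ^ Fintype.card ι) *
        ENNReal.ofReal (Real.exp (‖X ω‖ ^ 2 / (4 * K ^ 2))) ∂μ
      = ∫⁻ ω, ∫⁻ v : EuclideanSpace ℝ ι, ENNReal.ofReal (Real.exp (-K ^ 2 * ‖v‖ ^ 2)) *
          ENNReal.ofReal (Real.exp (inner ℝ (X ω) v)) ∂volume ∂μ := lintegral_congr fun ω => hcomp _
    _ = ∫⁻ v : EuclideanSpace ℝ ι, ∫⁻ ω, ENNReal.ofReal (Real.exp (-K ^ 2 * ‖v‖ ^ 2)) *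
          ENNReal.ofReal (Real.exp (inner ℝ (X ω) v)) ∂μ ∂volume := by
        apply lintegral_lintegral_swap
        apply Measurable.aemeasurable
        have hin : Measurable fun z : Ω × EuclideanSpace ℝ ι => inner ℝ (X z.1) z.2 :=
          (hX.comp measurable_fst).inner measurable_snd
        simp only [Function.uncurry_def]
        fun_prop
    -- The marginal bound consumes half of the exponent `K² ‖v‖²`; the Gaussian with the remaining
    -- half has an integral larger by `√2` per dimension.
    _ ≤ ∫⁻ v : EuclideanSpace ℝ ι,
          ENNReal.ofReal (Real.exp (-(K ^ 2 / 2) * ‖v‖ ^ 2)) * 9 := by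
        refine lintegral_mono fun v => ?_
        rw [lintegral_const_mul' _ _ ENNReal.ofReal_ne_top]
        refine (mul_le_mul_right (h1 v) _).trans ?_
        rw [← mul_assoc, ← ENNReal.ofReal_mul (Real.exp_pos _).le, ← Real.exp_add]
        apply le_of_eq
        congr 3
        ring
    _ = _ := by
        rw [lintegral_mul_const' _ _ (by norm_num), lintegral_gaussian (by positivity),
          finrank_euclideanSpace, ← ENNReal.ofReal_ofNat, ← ENNReal.ofReal_mul (by positivity),
          ← ENNReal.ofReal_mul (by positivity)]
        congr 1
        have : Real.pi / (K ^ 2 / 2) = Real.pi / K ^ 2 * 2 := by field_simp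
        rw [this, Real.sqrt_mul (by positivity), mul_pow]
        ring

/-- The two assumptions force `K c₀` to be bounded from below. -/
lemma one_le_mul_of_subGaussian_of_smallBall {ι : Type*} [Fintype ι] [Nonempty ι]
    {X : Ω → EuclideanSpace ℝ ι} {K c₀ : ℝ} (hK : 0 < K)
    (h : SubGaussianWith μ X K) (h' : SmallBallWith μ X c₀) : 1 ≤ 4 * (K * c₀) := by
  classical
  obtain ⟨i⟩ := ‹Nonempty ι›
  let θ : EuclideanSpace ℝ ι := EuclideanSpace.single i 1
  have hθ : ‖θ‖ = 1 := by simp [θ]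
  -- At level `2K` the tail is at most `2 exp (-4) ≤ 1/2`, so the small ball bound `2K c₀` must
  -- cover the other half.
  have h1 := h θ hθ (2 * K) (by positivity)
  have h2 := h' θ (by rw [← norm_ne_zero_iff, hθ]; norm_num) (2 * K) (by positivity)
  have h3 : (1 : ℝ) ≤ μ.real {ω | 2 * K ≤ |inner ℝ (X ω) θ|} +
      μ.real {ω | |inner ℝ θ (X ω)| ≤ 2 * K * ‖θ‖} := by
    rw [← probReal_univ (μ := μ)]
    refine le_trans (measureReal_mono ?_) (measureReal_union_le _ _)
    intro ω _
    rw [hθ, mul_one]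
    rcases le_total (2 * K) |inner ℝ (X ω) θ| with h4 | h4
    · exact Or.inl h4
    · exact Or.inr (by rw [Set.mem_ofPred_eq, real_inner_comm]; exact h4)
  have e : -(2 * K) ^ 2 / K ^ 2 = -4 := by field_simp; norm_num
  rw [e] at h1
  have h5 : Real.exp (-4) ≤ 1 / 4 := by
    rw [Real.exp_neg, one_div]
    apply inv_anti₀ (by norm_num)
    linarith [Real.add_one_le_exp (4 : ℝ)]
  linarith

end ExponentialMoments

/-! ### From pointwise expectations to events over the whole sphere. -/

section Markov

variable {Ω : Type*} [MeasurableSpace Ω] {μ : Measure Ω} [IsProbabilityMeasure μ]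

/-- Markov's inequality for an event on which some function on a ball is large on a set of
large volume. -/
lemma mul_measure_le_of_exists_large_set {n : ℕ} (hn : 0 < n)
    {h : Ω → EuclideanSpace ℝ (Fin n) → ℝ≥0∞} (hh : Measurable (Function.uncurry h))
    {S : Set Ω} {R q H : ℝ≥0∞} (hR : R ≠ ∞)
    (hS : ∀ ω ∈ S, ∃ B : Set (EuclideanSpace ℝ (Fin n)), MeasurableSet B ∧
      B ⊆ Metric.ball 0 2 ∧ volume (Metric.ball (0 : EuclideanSpace ℝ (Fin n)) 2) ≤ R * volume B ∧
      ∀ w ∈ B, q ≤ h ω w)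
    (hH : ∀ w, w ≠ 0 → ∫⁻ ω, h ω w ∂μ ≤ H) : q * μ S ≤ R * H := by
  have : Nonempty (Fin n) := ⟨⟨0, hn⟩⟩
  set V := volume (Metric.ball (0 : EuclideanSpace ℝ (Fin n)) 2) with hV
  have hV0 : V ≠ 0 := (Metric.measure_ball_pos _ _ (by norm_num)).ne'
  have hVt : V ≠ ∞ := measure_ball_lt_top.ne
  let G : Ω → ℝ≥0∞ := fun ω => ∫⁻ w in Metric.ball 0 2, h ω w
  have hG : Measurable G := hh.lintegral_prod_right'
  have hsub : S ⊆ {ω | q * V ≤ R * G ω} := by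
    intro ω hω
    obtain ⟨B, hB, hBs, hBv, hBq⟩ := hS ω hω
    have h1 : q * volume B ≤ G ω := by
      calc q * volume B = ∫⁻ _ in B, q := by simp
        _ ≤ ∫⁻ w in B, h ω w := setLIntegral_mono' hB hBq
        _ ≤ G ω := lintegral_mono_set hBs
    calc q * V ≤ q * (R * volume B) := by gcongr
      _ = R * (q * volume B) := by ring
      _ ≤ R * G ω := by gcongr
  have h2 : q * V * μ S ≤ R * H * V := by
    calc q * V * μ S ≤ q * V * μ {ω | q * V ≤ R * G ω} := by gcongr
      _ ≤ ∫⁻ ω, R * G ω ∂μ := mul_meas_ge_le_lintegral₀ (hG.const_mul R).aemeasurable _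
      _ = R * ∫⁻ ω, G ω ∂μ := lintegral_const_mul' _ _ hR
      _ = R * ∫⁻ w in Metric.ball 0 2, ∫⁻ ω, h ω w ∂μ := by
          rw [lintegral_lintegral_swap hh.aemeasurable]
      _ ≤ R * ∫⁻ _ in Metric.ball (0 : EuclideanSpace ℝ (Fin n)) 2, H := by
          refine mul_le_mul_right ?_ _
          refine lintegral_mono_ae ?_
          -- The origin is discarded, as it has no radial projection to the sphere.
          filter_upwards [ae_restrict_of_ae (Measure.ae_ne volume 0)] with w hw
          exact hH w hw
      _ = R * H * V := by rw [setLIntegral_const, mul_assoc]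
  rw [← ENNReal.mul_le_mul_iff_left hV0 hVt]
  calc q * μ S * V = q * V * μ S := by ring
    _ ≤ _ := h2

end Markov

/-! ### Pointwise exponential moments of the system and the tail of its Weyl norm. -/

section Tails

variable {n m : ℕ} {deg : Fin m → ℕ}

lemma exists_unit_orthogonal {k : ℕ} (x : EuclideanSpace ℝ (Fin (k + 2))) :
    ∃ y : EuclideanSpace ℝ (Fin (k + 2)), ‖y‖ = 1 ∧ inner ℝ x y = 0 := by
  have h1 := (ℝ ∙ x).finrank_add_finrank_orthogonal
  rw [finrank_euclideanSpace_fin] at h1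
  have h2 : Module.finrank ℝ ↥(ℝ ∙ x) ≤ 1 :=
    (finrank_span_le_card ({x} : Set _)).trans (by simp)
  have h3 : 0 < Module.finrank ℝ ↥((ℝ ∙ x)ᗮ) := by omega
  have : Nontrivial ↥((ℝ ∙ x)ᗮ) := Module.finrank_pos_iff.1 h3
  obtain ⟨y, hy⟩ := exists_norm_eq ↥((ℝ ∙ x)ᗮ) (zero_le_one : (0 : ℝ) ≤ 1)
  exact ⟨y, hy, Submodule.mem_orthogonal_singleton_iff_inner_right.1 y.2⟩

lemma continuous_evalSystem_forms (c : Coeffs n deg) : Continuous (evalSystem (forms c)) := by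
  have : evalSystem (forms c) = fun x => WithLp.toLp 2 fun i => inner ℝ (feat (deg i) x) (c i) := by
    funext x
    ext i
    exact evalSystem_forms_apply c x i
  rw [this]
  refine (PiLp.continuous_toLp 2 _).comp (continuous_pi fun i => ?_)
  exact continuous_feat.inner continuous_const

lemma norm_sq_evalSystem_forms (c : Coeffs n deg) (x : EuclideanSpace ℝ (Fin n)) :
    ‖evalSystem (forms c) x‖ ^ 2 = ∑ i, inner ℝ (feat (deg i) x) (c i) ^ 2 := by
  rw [EuclideanSpace.real_norm_sq_eq]
  simp only [evalSystem_forms_apply]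

/-- A system is at least half as large as at its maximum near a point where it is attained. -/
lemma half_le_norm_sphereEval (c : Coeffs n deg) {d : ℕ} (hd : 1 ≤ d)
    (hdeg : ∀ i, deg i ≤ d) {x v : EuclideanSpace ℝ (Fin n)}
    (hΓ : ∀ u : EuclideanSpace ℝ (Fin n), ‖u‖ = 1 →
      ‖evalSystem (forms c) u‖ ≤ ‖evalSystem (forms c) x‖)
    (hx : ‖x‖ = 1) (hv : inner ℝ x v = 0) (hvd : ‖v‖ ≤ 1 / (6 * d)) :
    ‖evalSystem (forms c) x‖ / 2 ≤ ‖sphereEval c (x + v)‖ := by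
  have hd0 : (1 : ℝ) ≤ d := by exact_mod_cast hd
  have h1 := norm_sphereEval_add_sub_le c hd hdeg hΓ hx hv
  have h3 : 3 * d * ‖evalSystem (forms c) x‖ * ‖v‖ ≤ ‖evalSystem (forms c) x‖ / 2 := by
    calc 3 * d * ‖evalSystem (forms c) x‖ * ‖v‖
        ≤ 3 * d * ‖evalSystem (forms c) x‖ * (1 / (6 * d)) := by gcongr
      _ = ‖evalSystem (forms c) x‖ / 2 := by field_simp; ring
  have h4 := norm_sub_norm_le (evalSystem (forms c) x) (sphereEval c (x + v))
  rw [norm_sub_rev] at h4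
  linarith

lemma norm_inv_norm_smul {E : Type*} [NormedAddCommGroup E] [NormedSpace ℝ E] {w : E}
    (hw : w ≠ 0) : ‖‖w‖⁻¹ • w‖ = 1 := by
  rw [norm_smul, norm_inv, norm_norm, inv_mul_cancel₀ (norm_ne_zero_iff.2 hw)]

variable {Ω : Type*} [MeasurableSpace Ω] {μ : Measure Ω}
  {X : (i : Fin m) → Ω → EuclideanSpace ℝ (MultiIndex n (deg i))}

lemma measurable_norm_sphereEval (hX : ∀ i, Measurable (X i)) :
    Measurable (Function.uncurry fun (ω : Ω) (w : EuclideanSpace ℝ (Fin n)) =>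
      ‖sphereEval (deg := deg) (fun i => X i ω) w‖ ^ 2) := by
  simp only [Function.uncurry_def, sphereEval, norm_sq_evalSystem_forms]
  refine Finset.measurable_sum _ fun i _ => Measurable.pow_const ?_ 2
  refine Measurable.inner ?_ ((hX i).comp measurable_fst)
  refine continuous_feat.measurable.comp ?_
  fun_prop

lemma lintegral_exp_sum_eq_prod (hX : ∀ i, Measurable (X i)) (hind : iIndepFun X μ)
    {h : (i : Fin m) → EuclideanSpace ℝ (MultiIndex n (deg i)) → ℝ} (hh : ∀ i, Measurable (h i)) :
    ∫⁻ ω, ENNReal.ofReal (Real.exp (∑ i, h i (X i ω))) ∂μ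
      = ∏ i, ∫⁻ ω, ENNReal.ofReal (Real.exp (h i (X i ω))) ∂μ := by
  have hm : ∀ i, Measurable fun c => ENNReal.ofReal (Real.exp (h i c)) := fun i =>
    ENNReal.measurable_ofReal.comp (Real.measurable_exp.comp (hh i))
  have := lintegral_prod_eq_prod_lintegral_of_indepFun Finset.univ
    (fun i ω => ENNReal.ofReal (Real.exp (h i (X i ω)))) (hind.comp _ hm)
    (fun i => (hm i).comp (hX i))
  rw [← this]
  refine lintegral_congr fun ω => ?_
  rw [Real.exp_sum, ENNReal.ofReal_prod_of_nonneg fun i _ => (Real.exp_pos _).le]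

variable [IsProbabilityMeasure μ]

lemma lintegral_exp_norm_sq_evalSystem_le (hX : ∀ i, Measurable (X i)) (hind : iIndepFun X μ)
    {K : ℝ} (hK : 0 < K) (hsg : ∀ i, SubGaussianWith μ (X i) K)
    {x : EuclideanSpace ℝ (Fin n)} (hx : ‖x‖ = 1) :
    ∫⁻ ω, ENNReal.ofReal (Real.exp
      (‖evalSystem (forms (deg := deg) fun i => X i ω) x‖ ^ 2 / (2 * K ^ 2))) ∂μ ≤ 9 ^ m := by
  simp only [norm_sq_evalSystem_forms, Finset.sum_div]
  rw [lintegral_exp_sum_eq_prod hX hind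
    (h := fun i c => inner ℝ (feat (deg i) x) c ^ 2 / (2 * K ^ 2)) (fun i => by fun_prop)]
  calc _ ≤ ∏ _i : Fin m, (9 : ℝ≥0∞) := by
        refine Finset.prod_le_prod' fun i _ => ?_
        refine lintegral_exp_sq_le (p := fun ω => inner ℝ (feat (deg i) x) (X i ω))
          (measurable_const.inner (hX i)) hK fun t ht => ?_
        simp only [real_inner_comm (X i _)]
        exact hsg i _ (by rw [norm_feat, hx, one_pow]) t ht
    _ = 9 ^ m := by simp

/-- By independence the `m` coordinates multiply, so the small ball bound is raised to the power
`m`. -/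
lemma lintegral_exp_neg_norm_sq_evalSystem_le (hX : ∀ i, Measurable (X i)) (hind : iIndepFun X μ)
    {c₀ ε : ℝ} (hc : 0 < c₀) (hε : 0 < ε) (hsb : ∀ i, SmallBallWith μ (X i) c₀)
    {x : EuclideanSpace ℝ (Fin n)} (hx : ‖x‖ = 1) :
    ∫⁻ ω, ENNReal.ofReal (Real.exp
      (-(‖evalSystem (forms (deg := deg) fun i => X i ω) x‖ ^ 2 / ε ^ 2))) ∂μ
      ≤ ENNReal.ofReal ((3 * c₀ * ε) ^ m) := by
  simp only [norm_sq_evalSystem_forms, Finset.sum_div, ← Finset.sum_neg_distrib]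
  rw [lintegral_exp_sum_eq_prod hX hind
    (h := fun i c => -(inner ℝ (feat (deg i) x) c ^ 2 / ε ^ 2)) (fun i => by fun_prop)]
  calc _ ≤ ∏ _i : Fin m, ENNReal.ofReal (3 * c₀ * ε) := by
        refine Finset.prod_le_prod' fun i _ => ?_
        refine lintegral_exp_neg_sq_le (p := fun ω => inner ℝ (feat (deg i) x) (X i ω))
          (measurable_const.inner (hX i)) hc hε fun t ht => ?_
        have hf : ‖feat (deg i) x‖ = 1 := by rw [norm_feat, hx, one_pow]
        have := hsb i (feat (deg i) x) (by rw [← norm_ne_zero_iff, hf]; norm_num) t ht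
        rwa [hf, mul_one] at this
    _ = _ := by
        rw [Finset.prod_const, Finset.card_univ, Fintype.card_fin,
          ENNReal.ofReal_pow (by positivity)]

lemma measure_le_sum_norm_sq_le (hn : 1 ≤ n) (hX : ∀ i, Measurable (X i)) (hind : iIndepFun X μ)
    {K : ℝ} (hK : 0 < K) (hsg : ∀ i, SubGaussianWith μ (X i) K) {N : ℕ}
    (hN : N = ∑ i, (n + deg i - 1).choose (deg i)) (r : ℝ) :
    μ {ω | 4 * K ^ 2 * r ≤ ∑ i, ‖X i ω‖ ^ 2} ≤ ENNReal.ofReal (Real.exp (3 * N - r)) := by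
  have h1 : ∫⁻ ω, ENNReal.ofReal (Real.exp (∑ i, ‖X i ω‖ ^ 2 / (4 * K ^ 2))) ∂μ
      ≤ ENNReal.ofReal (Real.exp (3 * N)) := by
    rw [lintegral_exp_sum_eq_prod hX hind (h := fun i c => ‖c‖ ^ 2 / (4 * K ^ 2))
      (fun i => by fun_prop)]
    have e : Real.exp (3 * N) = ∏ i, Real.exp 3 ^ (n + deg i - 1).choose (deg i) := by
      rw [Finset.prod_pow_eq_pow_sum, ← hN, mul_comm, Real.exp_nat_mul]
    rw [e, ENNReal.ofReal_prod_of_nonneg fun i _ => by positivity]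
    refine Finset.prod_le_prod' fun i _ => ?_
    refine ((hsg i).lintegral_exp_norm_sq_le (hX i) hK).trans ?_
    apply ENNReal.ofReal_le_ofReal
    rw [card_multiIndex]
    have hpos : (n + deg i - 1).choose (deg i) ≠ 0 :=
      (Nat.choose_pos (by omega)).ne'
    -- Each coefficient costs at most `9 √2 ≤ 27/2 ≤ exp 3`, which is where `3N` comes from.
    have h2 : √(2 : ℝ) ≤ 3 / 2 := by
      rw [Real.sqrt_le_left (by norm_num)]
      norm_num
    have h3 : 27 / 2 ≤ Real.exp 3 := by
      have : Real.exp 3 = Real.exp 1 ^ 3 := by rw [← Real.exp_nat_mul]; norm_num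
      rw [this]
      calc (27 / 2 : ℝ) ≤ 2.7 ^ 3 := by norm_num
        _ ≤ _ := pow_le_pow_left₀ (by norm_num) (by linarith [Real.exp_one_gt_d9]) 3
    calc 9 * √2 ^ (n + deg i - 1).choose (deg i)
        ≤ 9 ^ (n + deg i - 1).choose (deg i) * √2 ^ (n + deg i - 1).choose (deg i) := by
          gcongr
          exact le_self_pow₀ (by norm_num) hpos
      _ = (9 * √2) ^ (n + deg i - 1).choose (deg i) := (mul_pow _ _ _).symm
      _ ≤ _ := by
          gcongr
          linarith
  have h2 : ENNReal.ofReal (Real.exp r) * μ {ω | 4 * K ^ 2 * r ≤ ∑ i, ‖X i ω‖ ^ 2}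
      ≤ ENNReal.ofReal (Real.exp (3 * N)) := by
    refine le_trans ?_ h1
    refine le_trans ?_ (mul_meas_ge_le_lintegral₀ ?_ (ENNReal.ofReal (Real.exp r)))
    · refine mul_le_mul_right (measure_mono fun ω hω => ?_) _
      apply ENNReal.ofReal_le_ofReal
      apply Real.exp_le_exp.2
      rw [← Finset.sum_div, le_div_iff₀ (by positivity)]
      have : 4 * K ^ 2 * r ≤ ∑ i, ‖X i ω‖ ^ 2 := hω
      linarith
    · apply Measurable.aemeasurable
      fun_prop
  have h3 : ENNReal.ofReal (Real.exp r) ≠ 0 := by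
    rw [Ne, ENNReal.ofReal_eq_zero, not_le]
    exact Real.exp_pos _
  rw [← ENNReal.mul_le_mul_iff_right h3 ENNReal.ofReal_ne_top,
    ← ENNReal.ofReal_mul (Real.exp_pos _).le, ← Real.exp_add]
  rwa [add_sub_cancel]

end Tails

/-! ### Tail of the maximum, and small values together with a small derivative. -/

section LocalTails

variable {k m : ℕ} {deg : Fin m → ℕ} {Ω : Type*} [MeasurableSpace Ω] {μ : Measure Ω}
  [IsProbabilityMeasure μ] {X : (i : Fin m) → Ω → EuclideanSpace ℝ (MultiIndex (k + 2) (deg i))}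

/-- The tail of the maximum of a random system over the sphere. -/
lemma measure_exists_lt_norm_evalSystem_le (hX : ∀ i, Measurable (X i)) (hind : iIndepFun X μ)
    {K : ℝ} (hK : 0 < K) (hsg : ∀ i, SubGaussianWith μ (X i) K) {d : ℕ} (hd : 1 ≤ d)
    (hdeg : ∀ i, deg i ≤ d) {γ : ℝ} (hγ : 0 ≤ γ) :
    μ {ω | ∃ v, ‖v‖ = 1 ∧ γ < ‖evalSystem (forms (deg := deg) fun i => X i ω) v‖}
      ≤ ENNReal.ofReal (Real.exp 6 ^ (k + 2) * (12 * d) ^ (k + 1) * 9 ^ m *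
          Real.exp (-(γ ^ 2 / (8 * K ^ 2)))) := by
  have hd0 : (1 : ℝ) ≤ d := by exact_mod_cast hd
  -- The two tangential displacements add up to at most `2β = 1 / (6d)`, the range in which half of
  -- the maximum survives.
  set β : ℝ := 1 / (12 * d) with hβ
  have hβ0 : 0 < β := by positivity
  have hβ1 : β ≤ 1 := by
    rw [hβ, div_le_one (by positivity)]
    linarith
  have hmain := mul_measure_le_of_exists_large_set (μ := μ) (n := k + 2) (by omega)
    (h := fun ω w => ENNReal.ofReal (Real.exp
      (‖sphereEval (deg := deg) (fun i => X i ω) w‖ ^ 2 / (2 * K ^ 2))))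
    (S := {ω | ∃ v, ‖v‖ = 1 ∧ γ < ‖evalSystem (forms (deg := deg) fun i => X i ω) v‖})
    (R := ENNReal.ofReal (Real.exp 6 ^ (k + 2) / (β * β ^ k)))
    (q := ENNReal.ofReal (Real.exp (γ ^ 2 / (8 * K ^ 2)))) (H := 9 ^ m) ?_
    ENNReal.ofReal_ne_top ?_ ?_
  · have hq : ENNReal.ofReal (Real.exp (γ ^ 2 / (8 * K ^ 2))) ≠ 0 := by
      rw [Ne, ENNReal.ofReal_eq_zero, not_le]
      exact Real.exp_pos _
    rw [← ENNReal.mul_le_mul_iff_right hq ENNReal.ofReal_ne_top,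
      ← ENNReal.ofReal_mul (Real.exp_pos _).le]
    refine hmain.trans (le_of_eq ?_)
    have h9 : (9 : ℝ≥0∞) ^ m = ENNReal.ofReal (9 ^ m) := by
      rw [ENNReal.ofReal_pow (by norm_num), ENNReal.ofReal_ofNat]
    rw [h9, ← ENNReal.ofReal_mul (by positivity)]
    congr 1
    have e1 : β * β ^ k = (1 / (12 * d : ℝ)) ^ (k + 1) := by rw [pow_succ', hβ]
    rw [e1, one_div, inv_pow, div_inv_eq_mul, Real.exp_neg]
    have := Real.exp_ne_zero (γ ^ 2 / (8 * K ^ 2))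
    field_simp
  · simp only [Function.uncurry_def]
    have := measurable_norm_sphereEval (deg := deg) hX
    simp only [Function.uncurry_def] at this
    exact ENNReal.measurable_ofReal.comp (Real.measurable_exp.comp (this.div_const _))
  · rintro ω ⟨v, hv, hγv⟩
    set c : Coeffs (k + 2) deg := fun i => X i ω
    obtain ⟨x, hx, hmax⟩ := (isCompact_sphere (0 : EuclideanSpace ℝ (Fin (k + 2))) 1).exists_isMaxOn
      ⟨v, by simpa using hv⟩ (continuous_evalSystem_forms c).norm.continuousOn
    have hx1 : ‖x‖ = 1 := by simpa using hx
    have hΓ : ∀ v : EuclideanSpace ℝ (Fin (k + 2)), ‖v‖ = 1 →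
        ‖evalSystem (forms c) v‖ ≤ ‖evalSystem (forms c) x‖ :=
      fun v hv => hmax (by simpa using hv)
    obtain ⟨y, hy, hxy⟩ := exists_unit_orthogonal x
    obtain ⟨B, hB, hBs, hBw, hBv⟩ := exists_box hx1 hy hxy hβ0 hβ1 hβ0 hβ1
    refine ⟨B, hB, hBs, hBv, fun w hw => ?_⟩
    obtain ⟨a, b, z, ha, rfl, hb, hz, hxz, hyz⟩ := hBw w hw
    rw [sphereEval_smul c ha, add_assoc]
    have horth : inner ℝ x (b • y + z) = 0 := by
      rw [inner_add_right, inner_smul_right, hxy, hxz]; simp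
    have h2 : ‖b • y + z‖ ≤ 1 / (6 * d) := by
      refine (norm_add_le _ _).trans ?_
      rw [norm_smul, hy, mul_one, Real.norm_eq_abs]
      have : 1 / (6 * d : ℝ) = β + β := by rw [hβ]; field_simp; norm_num
      rw [this]
      exact add_le_add hb hz
    have h5 : γ / 2 ≤ ‖sphereEval c (x + (b • y + z))‖ := by
      have h3 := half_le_norm_sphereEval c hd hdeg hΓ hx1 horth h2
      have h4 := hγv.trans_le (hΓ v hv)
      linarith
    apply ENNReal.ofReal_le_ofReal
    apply Real.exp_le_exp.2
    have e : γ ^ 2 / (8 * K ^ 2) = (γ / 2) ^ 2 / (2 * K ^ 2) := by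
      field_simp; norm_num
    rw [e]
    gcongr
  · intro w hw
    exact lintegral_exp_norm_sq_evalSystem_le hX hind hK hsg (norm_inv_norm_smul hw)

/-- A random system that is bounded on the sphere is unlikely to be small, together with a
derivative in some tangent direction, at some point of the sphere. -/
lemma measure_exists_small_le (hm : 0 < m) (hX : ∀ i, Measurable (X i)) (hind : iIndepFun X μ)
    {c₀ : ℝ} (hc : 0 < c₀) (hsb : ∀ i, SmallBallWith μ (X i) c₀) {d : ℕ} (hd : 1 ≤ d)
    (hdeg : ∀ i, deg i ≤ d) {γ ρ : ℝ} (hγ : 0 < γ) (hρ : 0 < ρ) (hρ1 : ρ ≤ 1) :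
    μ {ω | (∀ v, ‖v‖ = 1 → ‖evalSystem (forms (deg := deg) fun i => X i ω) v‖ ≤ γ) ∧
      ∃ x y : EuclideanSpace ℝ (Fin (k + 2)), ‖x‖ = 1 ∧ ‖y‖ = 1 ∧ inner ℝ x y = 0 ∧
        ‖evalSystem (forms (deg := deg) fun i => X i ω) x‖ ≤ ρ ^ 2 * γ ∧
        ‖dirDeriv (forms (deg := deg) fun i => X i ω) x y‖ ≤ d * (ρ ^ 2 * γ)}
      ≤ ENNReal.ofReal (Real.exp 6 ^ (k + 2) * (3 * d) ^ (k + 1) / ρ ^ (2 * k + 1) *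
          (36 * c₀ * (ρ ^ 2 * γ) / √m) ^ m) := by
  have hd0 : (1 : ℝ) ≤ d := by exact_mod_cast hd
  have hm0 : (0 : ℝ) < m := by exact_mod_cast hm
  have hsm : 0 < √(m : ℝ) := Real.sqrt_pos.2 hm0
  set α := ρ ^ 2 * γ with hα
  have hα0 : 0 < α := by positivity
  -- These widths make the quadratic term `9d²γβ₁²` and the Lipschitz term `3dγβ₂` both equal to
  -- `α`. The first-order term is at most `α` too, so `‖P‖ ≤ 4α` on the box.
  set β₁ : ℝ := ρ / (3 * d) with hβ₁
  set β₂ : ℝ := ρ ^ 2 / (3 * d) with hβ₂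
  have hρ2 : ρ ^ 2 ≤ 1 := pow_le_one₀ hρ.le hρ1
  have hβ₁0 : 0 < β₁ := by positivity
  have hβ₂0 : 0 < β₂ := by positivity
  have hβ₁1 : β₁ ≤ 1 := by rw [hβ₁, div_le_one (by positivity)]; linarith
  have hβ₂1 : β₂ ≤ 1 := by rw [hβ₂, div_le_one (by positivity)]; linarith
  -- With this scale `‖P‖² / ε² ≤ m` on the box, so Markov loses only `exp m`, absorbed in the power
  -- of order `m`.
  set ε : ℝ := 4 * α / √m with hε
  have hε0 : 0 < ε := by positivity
  have hmain := mul_measure_le_of_exists_large_set (μ := μ) (n := k + 2) (by omega)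
    (h := fun ω w => ENNReal.ofReal (Real.exp
      (-(‖sphereEval (deg := deg) (fun i => X i ω) w‖ ^ 2 / ε ^ 2))))
    (S := {ω | (∀ v, ‖v‖ = 1 → ‖evalSystem (forms (deg := deg) fun i => X i ω) v‖ ≤ γ) ∧
      ∃ x y : EuclideanSpace ℝ (Fin (k + 2)), ‖x‖ = 1 ∧ ‖y‖ = 1 ∧ inner ℝ x y = 0 ∧
        ‖evalSystem (forms (deg := deg) fun i => X i ω) x‖ ≤ α ∧
        ‖dirDeriv (forms (deg := deg) fun i => X i ω) x y‖ ≤ d * α})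
    (R := ENNReal.ofReal (Real.exp 6 ^ (k + 2) / (β₁ * β₂ ^ k)))
    (q := ENNReal.ofReal (Real.exp (-m))) (H := ENNReal.ofReal ((3 * c₀ * ε) ^ m)) ?_
    ENNReal.ofReal_ne_top ?_ ?_
  · have hq : ENNReal.ofReal (Real.exp (-m)) ≠ 0 := by
      rw [Ne, ENNReal.ofReal_eq_zero, not_le]
      exact Real.exp_pos _
    rw [← ENNReal.mul_le_mul_iff_right hq ENNReal.ofReal_ne_top,
      ← ENNReal.ofReal_mul (Real.exp_pos _).le]
    refine hmain.trans ?_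
    rw [← ENNReal.ofReal_mul (by positivity)]
    apply ENNReal.ofReal_le_ofReal
    have e1 : β₁ * β₂ ^ k = ρ ^ (2 * k + 1) / (3 * d) ^ (k + 1) := by
      rw [hβ₁, hβ₂, div_pow, div_mul_div_comm, ← pow_mul, ← pow_succ', ← pow_succ']
    have e2 : (3 * c₀ * ε) ^ m ≤ Real.exp (-m) * (36 * c₀ * α / √m) ^ m := by
      have e3 : Real.exp (-m) = (Real.exp (-1)) ^ m := by
        rw [← Real.exp_nat_mul]; congr 1; ring
      rw [e3, ← mul_pow]
      refine pow_le_pow_left₀ (by positivity) ?_ m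
      have e4 : (3 : ℝ)⁻¹ ≤ Real.exp (-1) := by
        rw [Real.exp_neg]
        apply inv_anti₀ (Real.exp_pos _)
        linarith [Real.exp_one_lt_d9]
      calc 3 * c₀ * ε = 3⁻¹ * (36 * c₀ * α / √m) := by rw [hε]; ring
        _ ≤ _ := by gcongr
    rw [e1, div_div_eq_mul_div]
    calc _ ≤ Real.exp 6 ^ (k + 2) * (3 * ↑d) ^ (k + 1) / ρ ^ (2 * k + 1) *
          (Real.exp (-m) * (36 * c₀ * α / √m) ^ m) := by gcongr
      _ = _ := by ring
  · simp only [Function.uncurry_def]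
    have := measurable_norm_sphereEval (deg := deg) hX
    simp only [Function.uncurry_def] at this
    exact ENNReal.measurable_ofReal.comp (Real.measurable_exp.comp (this.div_const _).neg)
  · rintro ω ⟨hΓ, x, y, hx1, hy, hxy, hPx, hDx⟩
    set c : Coeffs (k + 2) deg := fun i => X i ω
    obtain ⟨B, hB, hBs, hBw, hBv⟩ := exists_box hx1 hy hxy hβ₁0 hβ₁1 hβ₂0 hβ₂1
    refine ⟨B, hB, hBs, hBv, fun w hw => ?_⟩
    obtain ⟨a, b, z, ha, rfl, hb, hz, hxz, hyz⟩ := hBw w hw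
    rw [sphereEval_smul c ha]
    have h1 := norm_sphereEval_le c hd hdeg hΓ hx1 hy hxy hxz hyz b
    have h2 : |b| * ‖dirDeriv (forms c) x y‖ ≤ α := by
      calc |b| * ‖dirDeriv (forms c) x y‖ ≤ β₁ * (d * α) := by gcongr
        _ = ρ / 3 * α := by rw [hβ₁]; field_simp
        _ ≤ 1 * α := by gcongr; linarith
        _ = α := one_mul α
    have h3 : 9 * d ^ 2 * γ * b ^ 2 ≤ α := by
      have : b ^ 2 ≤ β₁ ^ 2 := by
        rw [← sq_abs]
        gcongr
      calc 9 * d ^ 2 * γ * b ^ 2 ≤ 9 * d ^ 2 * γ * β₁ ^ 2 := by gcongr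
        _ = α := by rw [hβ₁, hα]; field_simp; norm_num
    have h4 : 3 * d * γ * ‖z‖ ≤ α := by
      calc 3 * d * γ * ‖z‖ ≤ 3 * d * γ * β₂ := by gcongr
        _ = α := by rw [hβ₂, hα]; field_simp
    have h5 : ‖sphereEval c (x + b • y + z)‖ ≤ 4 * α := by linarith
    apply ENNReal.ofReal_le_ofReal
    apply Real.exp_le_exp.2
    apply neg_le_neg
    rw [div_le_iff₀ (by positivity), hε, div_pow, Real.sq_sqrt hm0.le, mul_div_cancel₀ _ hm0.ne']
    gcongr
  · intro w hw
    exact lintegral_exp_neg_norm_sq_evalSystem_le hX hind hc hε0 hsb (norm_inv_norm_smul hw)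

end LocalTails

/-! ### The condition number through orthonormal pairs; positivity and measurability. -/

section Kappa

variable {n m : ℕ} {deg : Fin m → ℕ}

/-- The square of `L(P, x)` with the smallest singular value replaced by the size of the scaled
derivative in the tangent direction `y`. -/
noncomputable def gap (deg : Fin m → ℕ) (P : Fin m → MvPolynomial (Fin n) ℝ)
    (x y : EuclideanSpace ℝ (Fin n)) : ℝ :=
  ∑ i, dirDeriv P x y i ^ 2 / deg i + ‖evalSystem P x‖ ^ 2

lemma gap_nonneg (P : Fin m → MvPolynomial (Fin n) ℝ) (x y : EuclideanSpace ℝ (Fin n)) :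
    0 ≤ gap deg P x y := by
  unfold gap
  positivity

lemma inv_degMatrix (hdeg : ∀ i, 1 ≤ deg i) :
    (degMatrix deg)⁻¹ = Matrix.diagonal fun i => (√(deg i : ℝ))⁻¹ := by
  apply Matrix.inv_eq_right_inv
  rw [degMatrix, Matrix.diagonal_mul_diagonal, ← Matrix.diagonal_one]
  congr 1
  funext i
  have : (0 : ℝ) < deg i := by exact_mod_cast hdeg i
  exact mul_inv_cancel₀ (Real.sqrt_pos.2 this).ne'

lemma norm_sq_scaledTangentDeriv (hdeg : ∀ i, 1 ≤ deg i) (P : Fin m → MvPolynomial (Fin n) ℝ)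
    (x : EuclideanSpace ℝ (Fin n)) (y : ↥((ℝ ∙ x)ᗮ)) :
    ‖scaledTangentDeriv deg P x y‖ ^ 2 = ∑ i, dirDeriv P x y i ^ 2 / deg i := by
  rw [EuclideanSpace.real_norm_sq_eq]
  refine Finset.sum_congr rfl fun i _ => ?_
  have h : scaledTangentDeriv deg P x y i = (√(deg i : ℝ))⁻¹ * dirDeriv P x y i := by
    rw [scaledTangentDeriv, inv_degMatrix hdeg]
    simp [Matrix.toLpLin_apply, Matrix.mulVec, dotProduct, Matrix.diagonal_mul, dirDeriv, jacobian,
      Finset.mul_sum, mul_assoc]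
  rw [h, mul_pow, inv_pow, Real.sq_sqrt (Nat.cast_nonneg _), inv_mul_eq_div]

lemma localL_le_sqrt_gap (hdeg : ∀ i, 1 ≤ deg i) (P : Fin m → MvPolynomial (Fin n) ℝ)
    {x y : EuclideanSpace ℝ (Fin n)} (hy : ‖y‖ = 1) (hxy : inner ℝ x y = 0) :
    localL deg P x ≤ √(gap deg P x y) := by
  apply Real.sqrt_le_sqrt
  let y' : ↥((ℝ ∙ x)ᗮ) := ⟨y, Submodule.mem_orthogonal_singleton_iff_inner_right.2 hxy⟩
  have h := minSingularValue_le (scaledTangentDeriv deg P x) (y := y') hy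
  have h2 := pow_le_pow_left₀ (minSingularValue_nonneg _) h 2
  rw [norm_sq_scaledTangentDeriv hdeg] at h2
  exact add_le_add h2 le_rfl

lemma exists_localL_eq_sqrt_gap {k : ℕ} (hdeg : ∀ i, 1 ≤ deg i)
    (P : Fin m → MvPolynomial (Fin (k + 2)) ℝ) (x : EuclideanSpace ℝ (Fin (k + 2))) :
    ∃ y, ‖y‖ = 1 ∧ inner ℝ x y = 0 ∧ localL deg P x = √(gap deg P x y) := by
  have h1 := (ℝ ∙ x).finrank_add_finrank_orthogonal
  rw [finrank_euclideanSpace_fin] at h1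
  have h2 : Module.finrank ℝ ↥(ℝ ∙ x) ≤ 1 :=
    (finrank_span_le_card ({x} : Set _)).trans (by simp)
  obtain ⟨y, hy, hTy⟩ := exists_norm_eq_minSingularValue (scaledTangentDeriv deg P x) (by omega)
  refine ⟨y, hy, Submodule.mem_orthogonal_singleton_iff_inner_right.1 y.2, ?_⟩
  rw [localL, gap, ← hTy, norm_sq_scaledTangentDeriv hdeg]

lemma weylNorm_forms (c : Coeffs n deg) : weylNorm deg (forms c) = √(∑ i, ‖c i‖ ^ 2) := by
  simp only [weylNorm, weylSq_formOfCoeffs]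

lemma weylNorm_forms_pos {c : Coeffs n deg} (hc : c ≠ 0) : 0 < weylNorm deg (forms c) := by
  rw [weylNorm_forms, Real.sqrt_pos]
  obtain ⟨i, hi⟩ := Function.ne_iff.1 hc
  exact Finset.sum_pos' (fun i _ => sq_nonneg _)
    ⟨i, Finset.mem_univ i, by have := norm_pos_iff.2 hi; positivity⟩

lemma norm_evalSystem_forms_le (c : Coeffs n deg) {x : EuclideanSpace ℝ (Fin n)} (hx : ‖x‖ = 1) :
    ‖evalSystem (forms c) x‖ ≤ weylNorm deg (forms c) := by
  rw [weylNorm_forms]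
  apply Real.le_sqrt_of_sq_le
  rw [norm_sq_evalSystem_forms]
  refine Finset.sum_le_sum fun i _ => ?_
  rw [← sq_abs]
  refine pow_le_pow_left₀ (abs_nonneg _) ((abs_real_inner_le_norm _ _).trans ?_) 2
  rw [norm_feat, hx, one_pow, one_mul]

lemma eval_pderiv_formOfCoeffs {k : ℕ} (c : EuclideanSpace ℝ (MultiIndex n k)) (x : Fin n → ℝ)
    (j : Fin n) : MvPolynomial.eval x (MvPolynomial.pderiv j (formOfCoeffs c))
      = ∑ α : MultiIndex n k, c α * MvPolynomial.eval x (MvPolynomial.pderiv j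
        (MvPolynomial.monomial (α : Fin n →₀ ℕ) √((α : Fin n →₀ ℕ).multinomial : ℝ))) := by
  rw [formOfCoeffs_eq_sum_smul, map_sum, map_sum]
  refine Finset.sum_congr rfl fun α _ => ?_
  rw [Derivation.map_smul, MvPolynomial.smul_eval]

lemma continuous_gap_forms (x y : EuclideanSpace ℝ (Fin n)) :
    Continuous fun c : Coeffs n deg => gap deg (forms c) x y := by
  have h1 : ∀ i, Continuous fun c : Coeffs n deg => evalSystem (forms c) x i := by
    intro i
    simp only [evalSystem_forms_apply]
    fun_prop
  have h2 : ∀ i, Continuous fun c : Coeffs n deg => dirDeriv (forms c) x y i := by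
    intro i
    have h : ∀ j, Continuous fun c : Coeffs n deg =>
        MvPolynomial.eval (fun l => x l) (MvPolynomial.pderiv j (forms c i)) := by
      intro j
      simp only [forms, eval_pderiv_formOfCoeffs]
      refine continuous_finsetSum _ fun α _ => Continuous.mul ?_ continuous_const
      fun_prop
    exact continuous_finsetSum Finset.univ fun j _ => (h j).mul (continuous_const (y := y j))
  simp only [gap, EuclideanSpace.real_norm_sq_eq]
  exact (continuous_finsetSum _ fun i _ => ((h2 i).pow 2).div_const _).add
    (continuous_finsetSum _ fun i _ => (h1 i).pow 2)

/-- A large condition number is witnessed by an orthonormal pair. -/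
lemma exists_gap_le_of_le_kappa {k : ℕ} (hdeg : ∀ i, 1 ≤ deg i) (c : Coeffs (k + 2) deg) {s : ℝ}
    (hs : 0 < s) (h : ENNReal.ofReal s ≤ kappa deg (forms c)) :
    ∃ x y : EuclideanSpace ℝ (Fin (k + 2)), ‖x‖ = 1 ∧ ‖y‖ = 1 ∧ inner ℝ x y = 0 ∧
      (s / 2) ^ 2 * gap deg (forms c) x y ≤ ∑ i, ‖c i‖ ^ 2 := by
  -- Halving makes the inequality strict, so a point with local condition number above `s / 2`
  -- exists whether or not the supremum is attained.
  have h1 : ENNReal.ofReal (s / 2) < kappa deg (forms c) :=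
    lt_of_lt_of_le ((ENNReal.ofReal_lt_ofReal_iff hs).2 (by linarith)) h
  rw [kappa, lt_iSup_iff] at h1
  obtain ⟨x, h1⟩ := h1
  rw [lt_iSup_iff] at h1
  obtain ⟨hx, h1⟩ := h1
  obtain ⟨y, hy, hxy, hL⟩ := exists_localL_eq_sqrt_gap hdeg (forms c) x
  refine ⟨x, y, by simpa using hx, hy, hxy, ?_⟩
  rw [localKappa] at h1
  split_ifs at h1 with h0
  · have h2 : gap deg (forms c) x y = 0 := by
      rw [hL, Real.sqrt_eq_zero (gap_nonneg _ _ _)] at h0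
      exact h0
    rw [h2, mul_zero]
    positivity
  · have hLpos : 0 < localL deg (forms c) x :=
      lt_of_le_of_ne (Real.sqrt_nonneg _) (Ne.symm h0)
    have h2 := (ENNReal.ofReal_lt_ofReal_iff_of_nonneg (by positivity)).1 h1
    rw [lt_div_iff₀ hLpos] at h2
    have h3 := pow_le_pow_left₀ (by positivity) h2.le 2
    rwa [mul_pow, hL, Real.sq_sqrt (gap_nonneg _ _ _), weylNorm_forms,
      Real.sq_sqrt (by positivity)] at h3

/-- The Weyl norm dominates `‖P‖` on the sphere, so Bernstein gives `(3dΓ)² + Γ² ≤ (4dΓ)²`. -/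
lemma gap_forms_le (hdeg : ∀ i, 1 ≤ deg i) {d : ℕ} (hd : 1 ≤ d) (hdegd : ∀ i, deg i ≤ d)
    (c : Coeffs n deg) {x y : EuclideanSpace ℝ (Fin n)} (hx : ‖x‖ = 1) (hy : ‖y‖ = 1)
    (hxy : inner ℝ x y = 0) :
    gap deg (forms c) x y ≤ (4 * d * weylNorm deg (forms c)) ^ 2 := by
  set Γ := weylNorm deg (forms c)
  have hd0 : (1 : ℝ) ≤ d := by exact_mod_cast hd
  have h1 := (bernstein_forms c hd hdegd (fun v hv => norm_evalSystem_forms_le c hv)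
    hx hy hxy 0).1
  have h2 := norm_evalSystem_forms_le c hx
  have h3 : ∑ i, dirDeriv (forms c) x y i ^ 2 / deg i ≤ ‖dirDeriv (forms c) x y‖ ^ 2 := by
    rw [EuclideanSpace.real_norm_sq_eq]
    refine Finset.sum_le_sum fun i _ => div_le_self (sq_nonneg _) ?_
    exact_mod_cast hdeg i
  have h4 := pow_le_pow_left₀ (norm_nonneg _) h1 2
  have h5 := pow_le_pow_left₀ (norm_nonneg _) h2 2
  have h6 : Γ ^ 2 ≤ d ^ 2 * Γ ^ 2 :=
    le_mul_of_one_le_left (sq_nonneg _) (one_le_pow₀ hd0)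
  rw [gap]
  nlinarith [mul_nonneg (sq_nonneg (d : ℝ)) (sq_nonneg Γ)]

/-- This deterministic lower bound keeps the logarithm of the condition number bounded below. -/
lemma le_kappa_forms {k : ℕ} (hdeg : ∀ i, 1 ≤ deg i) {d : ℕ} (hd : 1 ≤ d)
    (hdegd : ∀ i, deg i ≤ d) (c : Coeffs (k + 2) deg) :
    ENNReal.ofReal (1 / (4 * d)) ≤ kappa deg (forms c) := by
  have hd0 : (1 : ℝ) ≤ d := by exact_mod_cast hd
  let x : EuclideanSpace ℝ (Fin (k + 2)) := EuclideanSpace.single 0 1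
  have hx : ‖x‖ = 1 := by simp [x]
  obtain ⟨y, hy, hxy⟩ := exists_unit_orthogonal x
  refine le_trans ?_ (le_iSup₂ (f := fun x _ => localKappa deg (forms c) x) x (by simpa using hx))
  rw [localKappa]
  split_ifs with h0
  · exact le_top
  · apply ENNReal.ofReal_le_ofReal
    have hLpos : 0 < localL deg (forms c) x := lt_of_le_of_ne (Real.sqrt_nonneg _) (Ne.symm h0)
    have h1 : localL deg (forms c) x ≤ 4 * d * weylNorm deg (forms c) := by
      refine (localL_le_sqrt_gap hdeg _ hy hxy).trans ?_
      refine Real.sqrt_le_iff.2 ⟨?_, gap_forms_le hdeg hd hdegd c hx hy hxy⟩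
      exact mul_nonneg (by positivity) (Real.sqrt_nonneg _)
    rw [div_le_div_iff₀ (by positivity) hLpos]
    linarith

/-- Replacing the singular value by an infimum over tangent vectors gives an index set independent
of `c` and continuous functions of `c`, which settles measurability. The case `c = 0` is excluded
because `0 * ∞ = 0`, while the condition number is then `∞`. -/
lemma kappa_forms_eq {k : ℕ} (hdeg : ∀ i, 1 ≤ deg i) {c : Coeffs (k + 2) deg} (hc : c ≠ 0) :
    kappa deg (forms c) = ENNReal.ofReal (weylNorm deg (forms c)) *
      (⨅ p ∈ {p : EuclideanSpace ℝ (Fin (k + 2)) × EuclideanSpace ℝ (Fin (k + 2)) |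
        ‖p.1‖ = 1 ∧ ‖p.2‖ = 1 ∧ inner ℝ p.1 p.2 = 0},
        ENNReal.ofReal √(gap deg (forms c) p.1 p.2))⁻¹ := by
  have hw := weylNorm_forms_pos hc
  have hloc : ∀ x, localKappa deg (forms c) x
      = ENNReal.ofReal (weylNorm deg (forms c)) * (ENNReal.ofReal (localL deg (forms c) x))⁻¹ := by
    intro x
    rw [localKappa]
    split_ifs with h0
    · rw [h0, ENNReal.ofReal_zero, ENNReal.inv_zero, ENNReal.mul_top]
      rw [Ne, ENNReal.ofReal_eq_zero, not_le]
      exact hw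
    · have hLpos : 0 < localL deg (forms c) x := lt_of_le_of_ne (Real.sqrt_nonneg _) (Ne.symm h0)
      rw [ENNReal.ofReal_div_of_pos hLpos, div_eq_mul_inv]
  simp only [kappa, hloc, ENNReal.inv_iInf, ENNReal.mul_iSup]
  apply le_antisymm
  · refine iSup₂_le fun x hx => ?_
    obtain ⟨y, hy, hxy, hL⟩ := exists_localL_eq_sqrt_gap hdeg (forms c) x
    rw [hL]
    exact le_iSup₂ (f := fun (p : EuclideanSpace ℝ (Fin (k + 2)) × EuclideanSpace ℝ (Fin (k + 2)))
      (_ : p ∈ {p : EuclideanSpace ℝ (Fin (k + 2)) × EuclideanSpace ℝ (Fin (k + 2)) |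
        ‖p.1‖ = 1 ∧ ‖p.2‖ = 1 ∧ inner ℝ p.1 p.2 = 0}) =>
      ENNReal.ofReal (weylNorm deg (forms c)) *
        (ENNReal.ofReal √(gap deg (forms c) p.1 p.2))⁻¹) (x, y) ⟨by simpa using hx, hy, hxy⟩
  · refine iSup₂_le ?_
    rintro ⟨x, y⟩ ⟨hx, hy, hxy⟩
    refine le_trans ?_ (le_iSup₂ (f := fun x (_ : x ∈ Metric.sphere _ _) =>
      ENNReal.ofReal (weylNorm deg (forms c)) * (ENNReal.ofReal (localL deg (forms c) x))⁻¹)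
      x (by simpa using hx))
    refine mul_le_mul_right (ENNReal.inv_le_inv.2 (ENNReal.ofReal_le_ofReal ?_)) _
    exact localL_le_sqrt_gap hdeg _ hy hxy

lemma kappa_forms_zero {k : ℕ} : kappa deg (forms (0 : Coeffs (k + 2) deg)) = ∞ := by
  let x : EuclideanSpace ℝ (Fin (k + 2)) := EuclideanSpace.single 0 1
  have hx : ‖x‖ = 1 := by simp [x]
  have hP : ∀ i, forms (0 : Coeffs (k + 2) deg) i = 0 := fun i => by
    simp [forms, formOfCoeffs]
  have hT : scaledTangentDeriv deg (forms (0 : Coeffs (k + 2) deg)) x = 0 := by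
    have : jacobian (forms (0 : Coeffs (k + 2) deg)) x = 0 := by
      ext i j
      simp only [jacobian, Matrix.of_apply, hP, map_zero, Matrix.zero_apply]
    rw [scaledTangentDeriv, this, Matrix.mul_zero, map_zero, LinearMap.zero_comp]
  have hE : evalSystem (forms (0 : Coeffs (k + 2) deg)) x = 0 := by
    ext i
    simp only [evalSystem, hP, map_zero, PiLp.zero_apply]
  have hL : localL deg (forms (0 : Coeffs (k + 2) deg)) x = 0 := by
    rw [localL, hT, hE, minSingularValue]
    simp
  rw [eq_top_iff]
  refine le_trans ?_ (le_iSup₂ (f := fun x _ => localKappa deg (forms _) x) x (by simpa using hx))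
  rw [localKappa, if_pos hL]

/-- An infimum of continuous functions, even an uncountable one, is upper semicontinuous, hence
measurable. -/
lemma measurable_kappa_forms {k : ℕ} (hdeg : ∀ i, 1 ≤ deg i) :
    Measurable fun c : Coeffs (k + 2) deg => kappa deg (forms c) := by
  classical
  have h1 : (fun c : Coeffs (k + 2) deg => kappa deg (forms c)) = fun c =>
      if c ∈ ({0} : Set (Coeffs (k + 2) deg)) then ∞ else ENNReal.ofReal (weylNorm deg (forms c)) *
      (⨅ p ∈ {p : EuclideanSpace ℝ (Fin (k + 2)) × EuclideanSpace ℝ (Fin (k + 2)) |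
        ‖p.1‖ = 1 ∧ ‖p.2‖ = 1 ∧ inner ℝ p.1 p.2 = 0},
        ENNReal.ofReal √(gap deg (forms c) p.1 p.2))⁻¹ := by
    funext c
    split_ifs with h
    · rw [Set.mem_singleton_iff.1 h, kappa_forms_zero]
    · exact kappa_forms_eq hdeg h
  rw [h1]
  refine Measurable.ite (measurableSet_singleton _) measurable_const ?_
  refine Measurable.mul ?_ (Measurable.inv ?_)
  · simp only [weylNorm_forms]
    apply Continuous.measurable
    refine ENNReal.continuous_ofReal.comp ?_
    fun_prop
  · apply UpperSemicontinuous.measurable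
    refine upperSemicontinuous_biInf fun p _ => Continuous.upperSemicontinuous ?_
    exact ENNReal.continuous_ofReal.comp (continuous_gap_forms p.1 p.2).sqrt

end Kappa

/-! ### The tail of the condition number. -/

section KappaTail

lemma norms_le_of_gap_le {n m : ℕ} {deg : Fin m → ℕ} (hdeg : ∀ i, 1 ≤ deg i) {d : ℕ} (hd : 1 ≤ d)
    (hdegd : ∀ i, deg i ≤ d) {P : Fin m → MvPolynomial (Fin n) ℝ} {x y : EuclideanSpace ℝ (Fin n)}
    {α : ℝ} (hα : 0 ≤ α) (h : gap deg P x y ≤ α ^ 2) :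
    ‖evalSystem P x‖ ≤ α ∧ ‖dirDeriv P x y‖ ≤ d * α := by
  have hd0 : (1 : ℝ) ≤ d := by exact_mod_cast hd
  have h5 : 0 ≤ ∑ i, dirDeriv P x y i ^ 2 / deg i := by positivity
  rw [gap] at h
  refine ⟨le_of_sq_le_sq (by linarith) hα, le_of_sq_le_sq ?_ (by positivity)⟩
  have h6 : ‖dirDeriv P x y‖ ^ 2 ≤ d * ∑ i, dirDeriv P x y i ^ 2 / deg i := by
    rw [EuclideanSpace.real_norm_sq_eq, Finset.mul_sum]
    refine Finset.sum_le_sum fun i _ => ?_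
    have h7 : (0 : ℝ) < deg i := by exact_mod_cast hdeg i
    have h8 : (deg i : ℝ) ≤ d := by exact_mod_cast hdegd i
    rw [← mul_div_assoc, le_div_iff₀ h7, mul_comm]
    gcongr
  have h9 : ∑ i, dirDeriv P x y i ^ 2 / deg i ≤ α ^ 2 := by
    linarith [sq_nonneg ‖evalSystem P x‖]
  calc ‖dirDeriv P x y‖ ^ 2 ≤ d * α ^ 2 := h6.trans (by gcongr)
    _ ≤ d ^ 2 * α ^ 2 := by
        gcongr
        nlinarith
    _ = _ := by ring

lemma mul_le_choose (a b : ℕ) : a * b + 1 ≤ (a + b).choose b := by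
  induction a with
  | zero => simp
  | succ a ih =>
    rcases b with _ | b
    · simp
    · have h1 : (a + 1 + (b + 1)).choose (b + 1)
          = (a + (b + 1)).choose b + (a + (b + 1)).choose (b + 1) := by
        rw [show a + 1 + (b + 1) = (a + (b + 1)) + 1 by ring, Nat.choose_succ_succ]
      have h2 : (b + 1).choose b ≤ (a + (b + 1)).choose b := Nat.choose_le_choose b (by omega)
      rw [Nat.choose_succ_self_right] at h2
      rw [h1]
      nlinarith

/-- The equation of largest degree alone has `(m + d).choose d ≥ m d` coefficients, and `log (e d) ≤
d`. Hence the threshold `exp (2N)` comes after `exp (2ml)`. -/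
lemma mul_log_le_sum_choose {k m : ℕ} (hm : m = k + 1) {deg : Fin m → ℕ} {d : ℕ} (hd : 1 ≤ d)
    (hmax : ∃ i, deg i = d) :
    (m : ℝ) * Real.log (Real.exp 1 * d) ≤ ((∑ i, (k + 2 + deg i - 1).choose (deg i) : ℕ) : ℝ) := by
  obtain ⟨i, hi⟩ := hmax
  have hd0 : (0 : ℝ) < d := by exact_mod_cast hd
  have h1 : m * d ≤ ∑ i, (k + 2 + deg i - 1).choose (deg i) := by
    refine le_trans ?_ (Finset.single_le_sum (f := fun i => (k + 2 + deg i - 1).choose (deg i))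
      (fun i _ => Nat.zero_le _) (Finset.mem_univ i))
    have h2 := mul_le_choose m d
    simp only [hi]
    rw [show k + 2 + d - 1 = m + d by omega]
    omega
  have h2 : Real.log (Real.exp 1 * d) ≤ d := by
    rw [Real.log_mul (Real.exp_ne_zero _) hd0.ne', Real.log_exp]
    linarith [Real.log_le_sub_one_of_pos hd0]
  calc (m : ℝ) * Real.log (Real.exp 1 * d) ≤ m * d := by gcongr
    _ ≤ _ := by exact_mod_cast h1

/-- One of the five units of `A` pays for `t ^ (-1/2)`; the other four give `(e d)^(-8)`, which is
below `1 / (24 d)`. -/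
lemma exp_neg_five_mul_le {d : ℕ} (hd : 2 ≤ d) {t A : ℝ} (ht : 1 ≤ t)
    (hA : 2 * Real.log (Real.exp 1 * d) ≤ A) (hA' : Real.log t ≤ 2 * A) :
    Real.exp (-(5 * A)) ≤ t ^ (-(1 / 2) : ℝ) / (24 * d) := by
  have hd0 : (2 : ℝ) ≤ d := by exact_mod_cast hd
  have ht0 : 0 < t := by linarith
  have hD : (5 : ℝ) ≤ Real.exp 1 * d := by nlinarith [Real.exp_one_gt_d9]
  have h1 : Real.exp (-A) ≤ t ^ (-(1 / 2) : ℝ) := by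
    rw [Real.rpow_def_of_pos ht0]
    apply Real.exp_le_exp.2
    linarith
  have h2 : Real.exp (-(4 * A)) ≤ 1 / (24 * d) := by
    have h3 : Real.exp (-(4 * A)) ≤ Real.exp (-((8 : ℕ) * Real.log (Real.exp 1 * d))) := by
      apply Real.exp_le_exp.2
      push_cast
      linarith
    refine h3.trans ?_
    rw [Real.exp_neg, Real.exp_nat_mul, Real.exp_log (by linarith), ← one_div]
    apply one_div_le_one_div_of_le (by linarith)
    have h4 : (5 : ℝ) ^ 7 ≤ (Real.exp 1 * d) ^ 7 := pow_le_pow_left₀ (by norm_num) hD 7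
    have h5 : (d : ℝ) ≤ Real.exp 1 * d :=
      le_mul_of_one_le_left (by linarith) (Real.one_le_exp (by norm_num))
    calc 24 * (d : ℝ) ≤ (5 : ℝ) ^ 7 * d := by
          gcongr; norm_num
      _ ≤ (Real.exp 1 * d) ^ 7 * (Real.exp 1 * d) := by gcongr
      _ = _ := by ring
  have e : Real.exp (-(5 * A)) = Real.exp (-A) * Real.exp (-(4 * A)) := by
    rw [← Real.exp_add]; congr 1; ring
  rw [e, div_eq_mul_one_div]
  gcongr

/-- The factor by which the tail of the condition number exceeds `t ^ (-1 / 2)`. -/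
noncomputable def tailFactor (m : ℕ) (l N t : ℝ) : ℝ :=
  max 1 (Real.log t / (2 * m * l)) ^ (((m : ℝ) - 1 / 2) / 2) *
    max 1 (Real.log t / (2 * N)) ^ (1 / 4 : ℝ)

lemma one_le_tailFactor {m : ℕ} (hm : 1 ≤ m) (l N t : ℝ) : 1 ≤ tailFactor m l N t := by
  have hm0 : (1 : ℝ) ≤ m := by exact_mod_cast hm
  have h1 := Real.one_le_rpow (le_max_left 1 (Real.log t / (2 * m * l)))
    (show 0 ≤ ((m : ℝ) - 1 / 2) / 2 by linarith)
  have h2 := Real.one_le_rpow (le_max_left 1 (Real.log t / (2 * N)))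
    (show (0 : ℝ) ≤ 1 / 4 by norm_num)
  unfold tailFactor
  nlinarith

/-- The constant of the condition number estimates. -/
noncomputable def condConst : ℝ := 24 * (1512 * Real.exp 12)

/-- The factor `√S ^ m` comes from the size of `γ`, and `ρ` returns `S ^ (-1/4) T ^ (1/4)`; together
they are the logarithmic factor of the theorem. -/
lemma sqrt_sqrt_div_eq {m : ℕ} {S T t : ℝ} (hS : 1 ≤ S) (hT : 1 ≤ T) (ht : 1 ≤ t) :
    √(√(T / S) / t) * √S ^ m
      = t ^ (-(1 / 2) : ℝ) * (S ^ (((m : ℝ) - 1 / 2) / 2) * T ^ (1 / 4 : ℝ)) := by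
  have hS0 : 0 < S := by linarith
  have hT0 : 0 < T := by linarith
  have ht0 : 0 < t := by linarith
  have e1 : √(√(T / S) / t) = T ^ (1 / 4 : ℝ) * (S ^ (1 / 4 : ℝ))⁻¹ * t ^ (-(1 / 2) : ℝ) := by
    rw [Real.sqrt_div (Real.sqrt_nonneg _), Real.rpow_neg ht0.le, ← Real.sqrt_eq_rpow,
      div_eq_mul_inv]
    congr 1
    rw [Real.sqrt_eq_rpow, Real.sqrt_eq_rpow, ← Real.rpow_mul (by positivity),
      Real.div_rpow hT0.le hS0.le, div_eq_mul_inv]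
    norm_num
  have e2 : √S ^ m = S ^ ((m : ℝ) / 2) := by
    rw [Real.sqrt_eq_rpow, ← Real.rpow_natCast, ← Real.rpow_mul hS0.le]
    congr 1
    ring
  have e3 : S ^ (((m : ℝ) - 1 / 2) / 2) = S ^ ((m : ℝ) / 2) * (S ^ (1 / 4 : ℝ))⁻¹ := by
    rw [← Real.rpow_neg hS0.le, ← Real.rpow_add hS0]
    congr 1
    ring
  rw [e1, e2, e3]
  ring

variable {k m : ℕ} {deg : Fin m → ℕ} {Ω : Type*} [MeasurableSpace Ω] {μ : Measure Ω}
  [IsProbabilityMeasure μ] {X : (i : Fin m) → Ω → EuclideanSpace ℝ (MultiIndex (k + 2) (deg i))}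

-- Outside a large Weyl norm (squared level `32K²TN`) and a large maximum (level `γ`), a large
-- condition number forces the small-value event. The factors `S` and `T` keep `log t` below `2Sml`
-- and `2TN`, so the first two events stay negligible for every `t`.
set_option maxHeartbeats 1000000 in
lemma measure_le_kappa_forms_le (hm : m = k + 1) (hk : 1 ≤ k) (hdeg : ∀ i, 1 ≤ deg i) {d : ℕ}
    (hd : 2 ≤ d) (hdegd : ∀ i, deg i ≤ d) (hmax : ∃ i, deg i = d)
    (hX : ∀ i, Measurable (X i)) (hind : iIndepFun X μ) {K c₀ : ℝ} (hK : 0 < K) (hc : 0 < c₀)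
    (hsg : ∀ i, SubGaussianWith μ (X i) K) (hsb : ∀ i, SmallBallWith μ (X i) c₀) {N : ℕ}
    (hN : N = ∑ i, (k + 2 + deg i - 1).choose (deg i)) {M : ℝ}
    (hM : √(N : ℝ) * ((K * c₀ * condConst * d * √(Real.log (Real.exp 1 * d))) ^ m * d) ^ 2 ≤ M)
    {t : ℝ} (ht : 1 ≤ t) :
    μ {ω | ENNReal.ofReal (t * M) ≤ kappa deg (forms fun i => X i ω)}
      ≤ ENNReal.ofReal (t ^ (-(1 / 2) : ℝ) * tailFactor m (Real.log (Real.exp 1 * d)) N t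
          / (8 * d)) := by
  set l := Real.log (Real.exp 1 * d) with hl
  have hd0 : (2 : ℝ) ≤ d := by exact_mod_cast hd
  have hl1 : 1 ≤ l := by
    rw [hl, Real.log_mul (Real.exp_ne_zero _) (by linarith), Real.log_exp]
    linarith [Real.log_nonneg (by linarith : (1 : ℝ) ≤ d)]
  have hm2 : 2 ≤ m := by omega
  have hm0 : (2 : ℝ) ≤ m := by exact_mod_cast hm2
  have hNl : (m : ℝ) * l ≤ N := by
    rw [hN]; exact mul_log_le_sum_choose hm (by omega) hmax
  have hml : 2 * l ≤ m * l := by gcongr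
  have hN0 : (2 : ℝ) ≤ N := by linarith
  have ht0 : 0 < t := by linarith
  have hlogt : 0 ≤ Real.log t := Real.log_nonneg ht
  set S : ℝ := max 1 (Real.log t / (2 * m * l)) with hS
  set T : ℝ := max 1 (Real.log t / (2 * N)) with hT
  have hS1 : 1 ≤ S := le_max_left _ _
  have hT1 : 1 ≤ T := le_max_left _ _
  have hSml : m * l ≤ S * (m * l) := le_mul_of_one_le_left (by positivity) hS1
  have hTN : (N : ℝ) ≤ T * N := le_mul_of_one_le_left (by positivity) hT1
  have hSt : Real.log t ≤ 2 * (S * (m * l)) := by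
    have := le_max_right 1 (Real.log t / (2 * m * l))
    rw [div_le_iff₀ (by positivity), ← hS] at this
    linarith
  have hTt : Real.log t ≤ 2 * (T * N) := by
    have := le_max_right 1 (Real.log t / (2 * N))
    rw [div_le_iff₀ (by positivity), ← hT] at this
    linarith
  have hTle : T ≤ t := by
    refine max_le ht ((div_le_self hlogt (by linarith)).trans ?_)
    linarith [Real.log_le_sub_one_of_pos ht0]
  have hsl : 1 ≤ √l := Real.one_le_sqrt.2 hl1
  have hF := one_le_tailFactor (m := m) (by omega) l N t
  set F := tailFactor m l N t with hFdef
  -- Here `176 = 8 · 22`: the exponent `γ² / 8K²` equals `22 S m l`, of which `17` absorb the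
  -- covering cost and `5` remain. Also `√176 ≤ 14`.
  set γ : ℝ := √(176 * K ^ 2 * (S * (m * l))) with hγ
  have hγ0 : 0 < γ := Real.sqrt_pos.2 (by positivity)
  have hγ2 : γ ^ 2 = 176 * K ^ 2 * (S * (m * l)) := Real.sq_sqrt (by positivity)
  set q : ℝ := (K * c₀ * condConst * d * √l) ^ m * d with hq
  have hKc : 1 ≤ 4 * (K * c₀) := by
    obtain ⟨i, -⟩ := hmax
    have : Nonempty (MultiIndex (k + 2) (deg i)) := by
      rw [← Fintype.card_pos_iff, card_multiIndex]
      exact Nat.choose_pos (by omega)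
    exact one_le_mul_of_subGaussian_of_smallBall hK (hsg i) (hsb i)
  have hC : 0 < condConst := by unfold condConst; positivity
  have hKcC : 1 ≤ K * c₀ * condConst := by
    have h1 : 4 ≤ condConst := by
      unfold condConst
      linarith [Real.one_le_exp (by norm_num : (0 : ℝ) ≤ 12)]
    nlinarith [mul_pos hK hc]
  have hq1 : 1 ≤ q := by
    have h1 : 1 ≤ K * c₀ * condConst * d * √l := by
      have h2 : 1 ≤ K * c₀ * condConst * d := one_le_mul_of_one_le_of_one_le hKcC (by linarith)
      exact one_le_mul_of_one_le_of_one_le h2 hsl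
    exact one_le_mul_of_one_le_of_one_le (one_le_pow₀ h1) (by linarith)
  have hM0 : 0 < M := lt_of_lt_of_le (by positivity) hM
  -- The ratio `T / S` balances the two truncation levels: `S` cancels from `(ρ² γ)²`, leaving the
  -- `T` of the Weyl norm level. The last factor `d` of `q` supplies the gain `1 / d`.
  set ρ : ℝ := √(√(T / S) / t) / q with hρ
  have hρ0 : 0 < ρ := by positivity
  have hρ2 : ρ ^ 2 = √(T / S) / t / q ^ 2 := by
    rw [hρ, div_pow, Real.sq_sqrt (by positivity)]
  have hρ1 : ρ ≤ 1 := by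
    rw [hρ]
    refine div_le_one_of_le₀ (le_trans ?_ hq1) (by linarith)
    rw [Real.sqrt_le_one, div_le_one ht0, Real.sqrt_le_left ht0.le, div_le_iff₀ (by linarith)]
    nlinarith
  have hρα : (2 / (t * M)) ^ 2 * (32 * K ^ 2 * (T * N)) ≤ (ρ ^ 2 * γ) ^ 2 := by
    have h1 : N * q ^ 4 ≤ M ^ 2 := by
      have := pow_le_pow_left₀ (by positivity) hM 2
      rw [mul_pow, Real.sq_sqrt (by positivity)] at this
      calc (N : ℝ) * q ^ 4 = N * (q ^ 2) ^ 2 := by ring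
        _ ≤ _ := this
    have e0 : (ρ ^ 2 * γ) ^ 2 = T / S / t ^ 2 / (q ^ 2) ^ 2 * (176 * K ^ 2 * (S * (m * l))) := by
      rw [mul_pow, hρ2, hγ2, div_pow, div_pow, Real.sq_sqrt (by positivity)]
    have e1 : (2 / (t * M)) ^ 2 * (32 * K ^ 2 * (T * N)) = 128 * K ^ 2 * T / t ^ 2 * (N / M ^ 2) := by
      field_simp; norm_num
    have e2 : T / S / t ^ 2 / (q ^ 2) ^ 2 * (176 * K ^ 2 * (S * (m * l)))
        = 176 * K ^ 2 * T / t ^ 2 * (m * l / q ^ 4) := by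
      field_simp
    rw [e0, e1, e2]
    have h2 : N / M ^ 2 ≤ m * l / q ^ 4 := by
      rw [div_le_div_iff₀ (by positivity) (by positivity)]
      have : 1 ≤ m * l := by linarith
      nlinarith [sq_nonneg M]
    gcongr
    norm_num
  have hsub : {ω | ENNReal.ofReal (t * M) ≤ kappa deg (forms fun i => X i ω)} ⊆
      {ω | 4 * K ^ 2 * (8 * (T * N)) ≤ ∑ i, ‖X i ω‖ ^ 2} ∪
      ({ω | ∃ v, ‖v‖ = 1 ∧ γ < ‖evalSystem (forms (deg := deg) fun i => X i ω) v‖} ∪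
      {ω | (∀ v, ‖v‖ = 1 → ‖evalSystem (forms (deg := deg) fun i => X i ω) v‖ ≤ γ) ∧
        ∃ x y : EuclideanSpace ℝ (Fin (k + 2)), ‖x‖ = 1 ∧ ‖y‖ = 1 ∧ inner ℝ x y = 0 ∧
          ‖evalSystem (forms (deg := deg) fun i => X i ω) x‖ ≤ ρ ^ 2 * γ ∧
          ‖dirDeriv (forms (deg := deg) fun i => X i ω) x y‖ ≤ d * (ρ ^ 2 * γ)}) := by
    intro ω hω
    by_cases h1 : 4 * K ^ 2 * (8 * (T * N)) ≤ ∑ i, ‖X i ω‖ ^ 2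
    · exact Or.inl h1
    · right
      by_cases h2 : ∃ v, ‖v‖ = 1 ∧ γ < ‖evalSystem (forms (deg := deg) fun i => X i ω) v‖
      · exact Or.inl h2
      · right
        push Not at h1 h2
        refine ⟨h2, ?_⟩
        obtain ⟨x, y, hx, hy, hxy, hg⟩ := exists_gap_le_of_le_kappa hdeg _
          (by positivity : 0 < t * M) hω
        set P := forms (deg := deg) fun i => X i ω
        have h3 : gap deg P x y ≤ (ρ ^ 2 * γ) ^ 2 := by
          refine le_trans ?_ hρα
          have h4 : (t * M / 2) ^ 2 * gap deg P x y ≤ 32 * K ^ 2 * (T * N) := by linarith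
          have e : gap deg P x y = (2 / (t * M)) ^ 2 * ((t * M / 2) ^ 2 * gap deg P x y) := by
            field_simp
          rw [e]
          gcongr
        exact ⟨x, y, hx, hy, hxy, norms_le_of_gap_le hdeg (by omega) hdegd (by positivity) h3⟩
  -- The first two events satisfy the bound without the factor `F ≥ 1`; only the third needs it.
  have hP : ∀ a : ℝ, a ≤ t ^ (-(1 / 2) : ℝ) / (24 * d) →
      a ≤ t ^ (-(1 / 2) : ℝ) * F / (24 * d) := by
    intro a ha
    refine ha.trans ?_
    have : 0 < t ^ (-(1 / 2) : ℝ) := Real.rpow_pos_of_pos ht0 _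
    gcongr
    exact le_mul_of_one_le_right this.le hF
  have hP1 := measure_le_sum_norm_sq_le (n := k + 2) (by omega) hX hind hK hsg hN (8 * (T * N))
  have hb1 : Real.exp (3 * N - 8 * (T * N)) ≤ t ^ (-(1 / 2) : ℝ) * F / (24 * d) := by
    refine hP _ (le_trans (Real.exp_le_exp.2 ?_) (exp_neg_five_mul_le hd ht (A := T * N)
      (by linarith) hTt))
    linarith
  have hP2 := measure_exists_lt_norm_evalSystem_le (k := k) hX hind hK hsg (d := d) (by omega)
    hdegd hγ0.le
  have hk2 : Real.exp 6 ^ (k + 2) ≤ Real.exp 12 ^ m := by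
    have : Real.exp 12 = Real.exp 6 ^ 2 := by rw [← Real.exp_nat_mul]; norm_num
    rw [this, ← pow_mul]
    exact pow_le_pow_right₀ (Real.one_le_exp (by norm_num)) (by omega)
  have hb2 : Real.exp 6 ^ (k + 2) * (12 * d) ^ (k + 1) * 9 ^ m *
      Real.exp (-(γ ^ 2 / (8 * K ^ 2))) ≤ t ^ (-(1 / 2) : ℝ) * F / (24 * d) := by
    refine hP _ (le_trans ?_ (exp_neg_five_mul_le hd ht (A := S * (m * l)) (by linarith) hSt))
    have e1 : γ ^ 2 / (8 * K ^ 2) = 22 * (S * (m * l)) := by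
      rw [hγ2]; field_simp; norm_num
    have h108 : (108 : ℝ) ≤ Real.exp 5 := by
      have : Real.exp 5 = Real.exp 1 ^ 5 := by rw [← Real.exp_nat_mul]; norm_num
      rw [this]
      calc (108 : ℝ) ≤ 2.7 ^ 5 := by norm_num
        _ ≤ _ := pow_le_pow_left₀ (by norm_num) (by linarith [Real.exp_one_gt_d9]) 5
    have hed : (d : ℝ) ≤ Real.exp (l - 1) := by
      rw [Real.exp_sub, hl, Real.exp_log (by positivity), mul_div_cancel_left₀ _ (Real.exp_ne_zero _)]
    rw [e1, ← hm]
    calc Real.exp 6 ^ (k + 2) * (12 * d) ^ m * 9 ^ m * Real.exp (-(22 * (S * (m * l))))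
        ≤ Real.exp 12 ^ m * (12 * d) ^ m * 9 ^ m * Real.exp (-(22 * (S * (m * l)))) := by gcongr
      _ = (Real.exp 12 * (108 * d)) ^ m * Real.exp (-(22 * (S * (m * l)))) := by
          rw [← mul_pow, ← mul_pow]; congr 2; ring
      _ ≤ (Real.exp 12 * (Real.exp 5 * Real.exp (l - 1))) ^ m *
          Real.exp (-(22 * (S * (m * l)))) := by
          gcongr
      _ ≤ Real.exp (m * (17 * l)) * Real.exp (-(22 * (S * (m * l)))) := by
          gcongr
          rw [← Real.exp_add, ← Real.exp_add, ← Real.exp_nat_mul]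
          apply Real.exp_le_exp.2
          gcongr
          linarith
      _ ≤ Real.exp (-(5 * (S * (m * l)))) := by
          rw [← Real.exp_add]
          apply Real.exp_le_exp.2
          linarith
  have hP3 := measure_exists_small_le (k := k) (by omega) hX hind hc hsb (d := d) (by omega)
    hdegd hγ0 hρ0 hρ1
  have hb3 : Real.exp 6 ^ (k + 2) * (3 * d) ^ (k + 1) / ρ ^ (2 * k + 1) *
      (36 * c₀ * (ρ ^ 2 * γ) / √m) ^ m ≤ t ^ (-(1 / 2) : ℝ) * F / (24 * d) := by
    have hsm : 0 < √(m : ℝ) := Real.sqrt_pos.2 (by linarith)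
    have e1 : γ / √m ≤ 14 * K * √l * √S := by
      rw [div_le_iff₀ hsm, hγ]
      apply Real.sqrt_le_iff.2 ⟨by positivity, ?_⟩
      rw [mul_pow, mul_pow, mul_pow, mul_pow, Real.sq_sqrt (by linarith),
        Real.sq_sqrt (by linarith), Real.sq_sqrt (by linarith)]
      have : 0 ≤ K ^ 2 * (S * (m * l)) := by positivity
      nlinarith
    -- Since `m = k + 1`, the powers `ρ^(2m)` and `ρ^(-(2k+1))` leave exactly one `ρ`.
    have e2 : Real.exp 6 ^ (k + 2) * (3 * d) ^ (k + 1) / ρ ^ (2 * k + 1) *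
        (36 * c₀ * (ρ ^ 2 * γ) / √m) ^ m
        = Real.exp 6 ^ (k + 2) * (108 * d * c₀ * (γ / √m)) ^ m * ρ := by
      rw [← hm]
      have e3 : 36 * c₀ * (ρ ^ 2 * γ) / √m = ρ ^ 2 * (36 * c₀ * (γ / √m)) := by ring
      have e4 : (ρ ^ 2) ^ m = ρ ^ (2 * k + 1) * ρ := by
        rw [← pow_mul, ← pow_succ]; congr 1; omega
      have e5 : 108 * d * c₀ * (γ / √m) = (3 * d) * (36 * c₀ * (γ / √m)) := by ring
      rw [e3, mul_pow (ρ ^ 2), e4, e5, mul_pow (3 * (d : ℝ))]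
      field_simp
    rw [e2]
    calc Real.exp 6 ^ (k + 2) * (108 * d * c₀ * (γ / √m)) ^ m * ρ
        ≤ Real.exp 12 ^ m * (108 * d * c₀ * (14 * K * √l * √S)) ^ m * ρ := by gcongr
      -- This fixes the constant: `1512 = 108 · 14`, and the extra `24` makes this event one of
      -- three equal shares of `1 / (8d)`.
      _ = (1 / 24 : ℝ) ^ m * (K * c₀ * condConst * d * √l) ^ m * √S ^ m * ρ := by
          rw [← mul_pow, ← mul_pow, ← mul_pow]
          congr 2
          unfold condConst
          ring
      _ = (1 / 24 : ℝ) ^ m * (√(√(T / S) / t) * √S ^ m) / d := by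
          rw [hρ, hq]
          have : (K * c₀ * condConst * d * √l) ^ m ≠ 0 := by positivity
          field_simp
      _ = (1 / 24 : ℝ) ^ m * (t ^ (-(1 / 2) : ℝ) * F) / d := by
          rw [sqrt_sqrt_div_eq hS1 hT1 ht, hFdef, tailFactor]
      _ ≤ (1 / 24 : ℝ) * (t ^ (-(1 / 2) : ℝ) * F) / d := by
          have h1 : (1 / 24 : ℝ) ^ m ≤ 1 / 24 :=
            pow_le_of_le_one (by norm_num) (by norm_num) (by omega)
          have : 0 < t ^ (-(1 / 2) : ℝ) := Real.rpow_pos_of_pos ht0 _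
          gcongr
      _ = _ := by field_simp
  have hpos : 0 ≤ t ^ (-(1 / 2) : ℝ) * F / (24 * d) := by
    have : 0 < t ^ (-(1 / 2) : ℝ) := Real.rpow_pos_of_pos ht0 _
    positivity
  calc _ ≤ _ := measure_mono hsub
    _ ≤ _ := (measure_union_le _ _).trans (add_le_add le_rfl (measure_union_le _ _))
    _ ≤ ENNReal.ofReal (t ^ (-(1 / 2) : ℝ) * F / (24 * d)) +
        (ENNReal.ofReal (t ^ (-(1 / 2) : ℝ) * F / (24 * d)) +
        ENNReal.ofReal (t ^ (-(1 / 2) : ℝ) * F / (24 * d))) := by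
        refine add_le_add (hP1.trans (ENNReal.ofReal_le_ofReal hb1))
          (add_le_add (hP2.trans (ENNReal.ofReal_le_ofReal hb2))
          (hP3.trans (ENNReal.ofReal_le_ofReal hb3)))
    _ = _ := by
        rw [← ENNReal.ofReal_add hpos hpos, ← ENNReal.ofReal_add hpos (by positivity)]
        congr 1
        field_simp
        norm_num

end KappaTail

/-! ### Moments and the expected logarithm from the tail. -/

section Moments

/-- As `N ≥ m l`, both maxima are at most `max 1 v`, with total exponent `m / 2`. Then `max 1 v ≤
exp (v / 2)` turns the logarithms into a small power of `t`. -/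
lemma tailFactor_le_rpow {m : ℕ} (hm : 1 ≤ m) {l N t : ℝ} (hl : 0 < l) (hN : m * l ≤ N)
    (ht : 1 ≤ t) : tailFactor m l N t ≤ t ^ (1 / (8 * l)) := by
  have hm0 : (1 : ℝ) ≤ m := by exact_mod_cast hm
  have hlogt := Real.log_nonneg ht
  have hml : 0 < m * l := by positivity
  set v := Real.log t / (2 * m * l) with hv
  have hv0 : 0 ≤ v := by positivity
  have hNv : Real.log t / (2 * N) ≤ v := by
    rw [hv, mul_assoc]
    gcongr
  have h1 : max 1 v ≤ Real.exp (v / 2) := by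
    refine max_le (Real.one_le_exp (by linarith)) ?_
    have h2 := Real.add_one_le_exp (v / 2 - 1)
    have h3 : Real.exp (v / 2) = Real.exp 1 * Real.exp (v / 2 - 1) := by
      rw [← Real.exp_add]; congr 1; ring
    rw [h3]
    nlinarith [Real.exp_one_gt_d9]
  have hS : 0 < max 1 v := lt_of_lt_of_le one_pos (le_max_left _ _)
  calc tailFactor m l N t
      ≤ max 1 v ^ (((m : ℝ) - 1 / 2) / 2) * max 1 v ^ (1 / 4 : ℝ) := by
        unfold tailFactor
        gcongr
    _ = max 1 v ^ ((m : ℝ) / 2) := by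
        rw [← Real.rpow_add hS]
        congr 1
        ring
    _ ≤ Real.exp (v / 2) ^ ((m : ℝ) / 2) := by gcongr
    _ = t ^ (1 / (8 * l)) := by
        rw [← Real.exp_mul, Real.rpow_def_of_pos (by linarith), hv]
        congr 1
        field_simp
        norm_num

variable {Ω : Type*} [MeasurableSpace Ω] {μ : Measure Ω} [IsProbabilityMeasure μ]

/-- Moments of a random variable with a tail of order slightly above `-1 / 2`. -/
lemma lintegral_rpow_le_of_tail {f : Ω → ℝ} (hf : Measurable f) (hf0 : ∀ ω, 0 ≤ f ω) {l D q : ℝ}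
    (hl : 1 ≤ l) (hD : l ≤ D) (hq : 0 < q) (hql : q ≤ 1 / 2 - 1 / (4 * l))
    (htail : ∀ t : ℝ, 1 ≤ t →
      μ {ω | t ≤ f ω} ≤ ENNReal.ofReal (t ^ (-(1 / 2) + 1 / (8 * l)) / (8 * D))) :
    ∫⁻ ω, ENNReal.ofReal (f ω ^ q) ∂μ ≤ ENNReal.ofReal (1 + q) := by
  have hD0 : 0 < D := by linarith
  set s : ℝ := -(1 / 2) + 1 / (8 * l) + (q - 1) with hs
  have hl8 : 1 / (4 * l) = 1 / (8 * l) + 1 / (8 * l) := by field_simp; norm_num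
  have hs1 : s + 1 ≤ -(1 / (8 * l)) := by rw [hs]; linarith
  have hl8pos : 0 < 1 / (8 * l) := by positivity
  have hs2 : s < -1 := by linarith
  have h1 : ∫⁻ t in Set.Ioc (0 : ℝ) 1, μ {ω | t ≤ f ω} * ENNReal.ofReal (t ^ (q - 1))
      ≤ ENNReal.ofReal (1 / q) := by
    calc _ ≤ ∫⁻ t in Set.Ioc (0 : ℝ) 1, ENNReal.ofReal (t ^ (q - 1)) :=
          lintegral_mono fun t => mul_le_of_le_one_left zero_le prob_le_one
      _ = ENNReal.ofReal (∫ t in Set.Ioc (0 : ℝ) 1, t ^ (q - 1)) := by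
          rw [ofReal_integral_eq_lintegral_ofReal]
          · exact (intervalIntegrable_iff_integrableOn_Ioc_of_le zero_le_one).1
              (intervalIntegral.intervalIntegrable_rpow' (by linarith))
          · filter_upwards [ae_restrict_mem measurableSet_Ioc] with t ht
            exact Real.rpow_nonneg ht.1.le _
      _ = _ := by
          rw [← intervalIntegral.integral_of_le zero_le_one, integral_rpow (Or.inl (by linarith))]
          rw [sub_add_cancel, Real.one_rpow, Real.zero_rpow hq.ne', sub_zero]
  have h2 : ∫⁻ t in Set.Ioi (1 : ℝ), μ {ω | t ≤ f ω} * ENNReal.ofReal (t ^ (q - 1))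
      ≤ ENNReal.ofReal 1 := by
    calc _ ≤ ∫⁻ t in Set.Ioi (1 : ℝ), ENNReal.ofReal (1 / (8 * D) * t ^ s) := by
          refine setLIntegral_mono' measurableSet_Ioi fun t ht => ?_
          have ht1 : (1 : ℝ) < t := ht
          refine (mul_le_mul_left (htail t ht1.le) _).trans ?_
          rw [← ENNReal.ofReal_mul (by positivity)]
          apply ENNReal.ofReal_le_ofReal
          have e : t ^ s = t ^ (-(1 / 2) + 1 / (8 * l)) * t ^ (q - 1) := by
            rw [hs]
            exact Real.rpow_add (by linarith) _ _
          rw [e]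
          apply le_of_eq
          ring
      _ = ENNReal.ofReal (∫ t in Set.Ioi (1 : ℝ), 1 / (8 * D) * t ^ s) := by
          rw [ofReal_integral_eq_lintegral_ofReal]
          · exact (integrableOn_Ioi_rpow_of_lt hs2 one_pos).const_mul _
          · filter_upwards [ae_restrict_mem measurableSet_Ioi] with t ht
            have ht1 : (1 : ℝ) < t := ht
            simp only [Pi.zero_apply]
            positivity
      _ ≤ _ := by
          apply ENNReal.ofReal_le_ofReal
          rw [integral_const_mul, integral_Ioi_rpow_of_lt hs2 one_pos, Real.one_rpow]
          -- The restriction on `q` leaves a margin `1 / (8l)` in the exponent, so the integral is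
          -- at most `8l ≤ 8D`, which the spare factor `1 / (8D)` cancels exactly.
          have h3 : -1 / (s + 1) ≤ 8 * l := by
            rw [div_le_iff_of_neg (by linarith)]
            have : 8 * l * (s + 1) ≤ 8 * l * (-(1 / (8 * l))) := by gcongr
            refine this.trans (le_of_eq ?_)
            field_simp
          calc 1 / (8 * D) * (-1 / (s + 1)) ≤ 1 / (8 * D) * (8 * D) := by
                gcongr
                linarith
            _ = 1 := by field_simp
  rw [lintegral_rpow_eq_lintegral_meas_le_mul μ (Filter.Eventually.of_forall hf0)
    hf.aemeasurable hq, ← Set.Ioc_union_Ioi_eq_Ioi (zero_le_one : (0 : ℝ) ≤ 1),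
    lintegral_union measurableSet_Ioi (Set.Ioc_disjoint_Ioi le_rfl)]
  calc _ ≤ ENNReal.ofReal q * (ENNReal.ofReal (1 / q) + ENNReal.ofReal 1) := by gcongr
    _ = _ := by
        rw [← ENNReal.ofReal_add (by positivity) (by norm_num), ← ENNReal.ofReal_mul hq.le]
        congr 1
        field_simp

/-- The sharp form `1 + q` of the moment matters for the logarithm, where `((1 + q) - 1) / q = 1`;
for the moments, `1 + q ≤ e` suffices. -/
lemma moments_of_tail {κ : Ω → ℝ≥0∞} (hκ : Measurable κ) {a M l D : ℝ} (ha : 0 < a) (hM : 0 < M)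
    (hl : 1 ≤ l) (hD : l ≤ D) (hlow : ∀ ω, ENNReal.ofReal a ≤ κ ω)
    (htail : ∀ t : ℝ, 1 ≤ t →
      μ {ω | ENNReal.ofReal (t * M) ≤ κ ω}
        ≤ ENNReal.ofReal (t ^ (-(1 / 2) + 1 / (8 * l)) / (8 * D))) :
    (∀ q : ℝ, 0 < q → q ≤ 1 / 2 - 1 / (4 * l) →
        (∫⁻ ω, κ ω ^ q ∂μ) ^ (1 / q) ≤ ENNReal.ofReal (M * Real.exp (1 / q))) ∧
      (∀ᵐ ω ∂μ, κ ω ≠ 0 ∧ κ ω ≠ ∞) ∧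
      Integrable (fun ω => Real.log (κ ω).toReal) μ ∧
      ∫ ω, Real.log (κ ω).toReal ∂μ ≤ 1 + Real.log M := by
  have hl8 : 1 / (4 * l) = 1 / (8 * l) + 1 / (8 * l) := by field_simp; norm_num
  have hl4 : 1 / (4 * l) ≤ 1 / 4 := by
    apply one_div_le_one_div_of_le (by norm_num); linarith
  have htop : ∀ᵐ ω ∂μ, κ ω ≠ ∞ := by
    rw [ae_iff]
    simp only [not_not]
    have h1 : ∀ t : ℝ, 1 ≤ t → μ {ω | κ ω = ∞}
        ≤ ENNReal.ofReal (t ^ (-(1 / 2 - 1 / (8 * l))) / (8 * D)) := by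
      intro t ht
      refine le_trans (measure_mono fun ω hω => ?_) ((htail t ht).trans (le_of_eq ?_))
      · have : κ ω = ∞ := hω
        simp [this]
      · rw [neg_sub]; congr 3; ring
    have h2 : Filter.Tendsto (fun t : ℝ => ENNReal.ofReal (t ^ (-(1 / 2 - 1 / (8 * l))) / (8 * D)))
        Filter.atTop (nhds 0) := by
      have := ENNReal.tendsto_ofReal ((tendsto_rpow_neg_atTop
        (show 0 < 1 / 2 - 1 / (8 * l) by linarith [show 0 < 1 / (8 * l) by positivity])).div_const
          (8 * D))
      simpa using this
    exact le_antisymm (ge_of_tendsto h2 ((Filter.eventually_ge_atTop 1).mono h1)) zero_le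
  have hpos : ∀ ω, κ ω ≠ 0 := fun ω =>
    (lt_of_lt_of_le (ENNReal.ofReal_pos.2 ha) (hlow ω)).ne'
  set Y : Ω → ℝ := fun ω => (κ ω).toReal with hY
  have hYm : Measurable Y := hκ.ennreal_toReal
  have hY0 : ∀ ω, 0 ≤ Y ω := fun ω => ENNReal.toReal_nonneg
  have hYlow : ∀ᵐ ω ∂μ, a ≤ Y ω := by
    filter_upwards [htop] with ω hω
    exact (ENNReal.ofReal_le_iff_le_toReal hω).1 (hlow ω)
  have hmom : ∀ q : ℝ, 0 < q → q ≤ 1 / 2 - 1 / (4 * l) →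
      ∫⁻ ω, ENNReal.ofReal ((Y ω / M) ^ q) ∂μ ≤ ENNReal.ofReal (1 + q) := by
    intro q hq hql
    refine lintegral_rpow_le_of_tail (hYm.div_const M) (fun ω => div_nonneg (hY0 ω) hM.le) hl hD
      hq hql fun t ht => le_trans (measure_mono fun ω hω => ?_) (htail t ht)
    have h1 : t ≤ Y ω / M := hω
    rw [le_div_iff₀ hM] at h1
    change ENNReal.ofReal (t * M) ≤ κ ω
    exact ENNReal.ofReal_le_of_le_toReal h1
  refine ⟨fun q hq hql => ?_, ?_, ?_⟩
  · have h1 : ∫⁻ ω, κ ω ^ q ∂μ = ENNReal.ofReal (M ^ q) *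
        ∫⁻ ω, ENNReal.ofReal ((Y ω / M) ^ q) ∂μ := by
      rw [← lintegral_const_mul' _ _ ENNReal.ofReal_ne_top]
      refine lintegral_congr_ae ?_
      filter_upwards [htop] with ω hω
      rw [← ENNReal.ofReal_mul (by positivity), ← Real.mul_rpow hM.le
        (div_nonneg (hY0 ω) hM.le), mul_div_cancel₀ _ hM.ne',
        ← ENNReal.ofReal_rpow_of_nonneg (hY0 ω) hq.le, ENNReal.ofReal_toReal hω]
    have h2 : ∫⁻ ω, κ ω ^ q ∂μ ≤ ENNReal.ofReal (M ^ q * Real.exp 1) := by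
      rw [h1, ENNReal.ofReal_mul (by positivity)]
      gcongr
      refine (hmom q hq hql).trans (ENNReal.ofReal_le_ofReal ?_)
      linarith [Real.exp_one_gt_d9, show 0 < 1 / (4 * l) by positivity]
    refine (ENNReal.rpow_le_rpow h2 (by positivity)).trans (le_of_eq ?_)
    rw [ENNReal.ofReal_rpow_of_nonneg (by positivity) (by positivity),
      Real.mul_rpow (by positivity) (by positivity), ← Real.rpow_mul hM.le,
      mul_one_div_cancel hq.ne', Real.rpow_one, ← Real.exp_mul, one_mul]
  · filter_upwards [htop] with ω hω
    exact ⟨hpos ω, hω⟩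
  · set q : ℝ := 1 / 2 - 1 / (4 * l) with hq
    have hq0 : 0 < q := by rw [hq]; linarith
    have hmq := hmom q hq0 le_rfl
    set g : Ω → ℝ := fun ω => (Y ω / M) ^ q with hg
    have hgm : Measurable g := (hYm.div_const M).pow_const q
    have hg0 : ∀ ω, 0 ≤ g ω := fun ω => Real.rpow_nonneg (div_nonneg (hY0 ω) hM.le) _
    have hgint : Integrable g μ := by
      refine ⟨hgm.aestronglyMeasurable, ?_⟩
      rw [hasFiniteIntegral_iff_ofReal (Filter.Eventually.of_forall hg0)]
      exact hmq.trans_lt ENNReal.ofReal_lt_top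
    have hgle : ∫ ω, g ω ∂μ ≤ 1 + q := by
      rw [integral_eq_lintegral_of_nonneg_ae (Filter.Eventually.of_forall hg0)
        hgm.aestronglyMeasurable]
      exact ENNReal.toReal_le_of_le_ofReal (by positivity) hmq
    -- This is `log y ≤ (y^q - 1) / q` at `y = Y / M`.
    have hup : ∀ᵐ ω ∂μ, Real.log (Y ω) ≤ Real.log M + (g ω - 1) / q := by
      filter_upwards [hYlow] with ω hω
      have hYp : 0 < Y ω := by linarith
      have h1 := Real.log_le_sub_one_of_pos (Real.rpow_pos_of_pos (div_pos hYp hM) q)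
      rw [Real.log_rpow (div_pos hYp hM), Real.log_div hYp.ne' hM.ne'] at h1
      have h2 : Real.log (Y ω) - Real.log M ≤ (g ω - 1) / q := by
        rw [le_div_iff₀ hq0]
        linarith
      linarith
    have hupint : Integrable (fun ω => Real.log M + (g ω - 1) / q) μ :=
      (integrable_const _).add ((hgint.sub (integrable_const 1)).div_const q)
    have hlogint : Integrable (fun ω => Real.log (Y ω)) μ := by
      refine Integrable.mono' (g := fun ω => |Real.log M + (g ω - 1) / q| + |Real.log a|)
        (hupint.abs.add (integrable_const _)) (Real.measurable_log.comp hYm).aestronglyMeasurable ?_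
      filter_upwards [hYlow, hup] with ω hω hω2
      have h1 := Real.log_le_log ha hω
      rw [Real.norm_eq_abs, abs_le]
      constructor
      · linarith [neg_abs_le (Real.log a), abs_nonneg (Real.log M + (g ω - 1) / q)]
      · linarith [le_abs_self (Real.log M + (g ω - 1) / q), abs_nonneg (Real.log a)]
    refine ⟨hlogint, (integral_mono_ae hlogint hupint hup).trans ?_⟩
    have e : ∫ ω, (Real.log M + (g ω - 1) / q) ∂μ = Real.log M + (∫ ω, g ω ∂μ - 1) / q := by
      rw [integral_add (f := fun _ => Real.log M) (g := fun ω => (g ω - 1) / q)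
        (integrable_const _) ((hgint.sub (integrable_const 1)).div_const q), integral_div,
        integral_sub hgint (integrable_const 1)]
      simp
    rw [e]
    have : (∫ ω, g ω ∂μ - 1) / q ≤ 1 := by
      rw [div_le_one hq0]
      linarith
    linarith

/-- The proof needs only `d^(2m+2) l^m`, which is below `(3d²l)^(2m-1)` once `m ≥ 2`, that is `n ≥
3`. -/
lemma condConst_scale_le {m d : ℕ} (hm : 2 ≤ m) (hd : 1 ≤ d) {B l ν R : ℝ} (hl : 1 ≤ l)
    (hν : 1 ≤ ν) (hR : 0 ≤ R) :
    R * ((B * d * √l) ^ m * d) ^ 2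
      ≤ R * B ^ (2 * m) * (3 * (d : ℝ) ^ 2 * l) ^ (2 * m - 1) * ν := by
  have hd0 : (1 : ℝ) ≤ d := by exact_mod_cast hd
  have hB : 0 ≤ B ^ (2 * m) := by rw [pow_mul]; positivity
  have e : ((B * d * √l) ^ m * d) ^ 2 = B ^ (2 * m) * ((d : ℝ) ^ (2 * m + 2) * l ^ m) := by
    rw [mul_pow, mul_pow, mul_pow, mul_pow, mul_pow, ← pow_mul √l, mul_comm m 2, pow_mul √l,
      Real.sq_sqrt (by linarith), pow_add, ← pow_mul, ← pow_mul, mul_comm m 2]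
    ring
  have h1 : (d : ℝ) ^ (2 * m + 2) * l ^ m ≤ (3 * (d : ℝ) ^ 2 * l) ^ (2 * m - 1) := by
    rw [mul_pow, mul_pow, ← pow_mul]
    have h2 : (d : ℝ) ^ (2 * m + 2) ≤ (d : ℝ) ^ (2 * (2 * m - 1)) :=
      pow_le_pow_right₀ hd0 (by omega)
    have h3 : l ^ m ≤ l ^ (2 * m - 1) := pow_le_pow_right₀ hl (by omega)
    have h4 : (1 : ℝ) ≤ 3 ^ (2 * m - 1) := one_le_pow₀ (by norm_num)
    gcongr
    exact h2.trans (le_mul_of_one_le_left (by positivity) h4)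
  rw [e, ← mul_assoc]
  calc R * B ^ (2 * m) * ((d : ℝ) ^ (2 * m + 2) * l ^ m)
      ≤ R * B ^ (2 * m) * (3 * (d : ℝ) ^ 2 * l) ^ (2 * m - 1) := by gcongr
    _ ≤ _ := le_mul_of_one_le_right (by positivity) hν

end Moments

end RandomSystem

/-! ### Assembly of the tail regimes, moments and logarithm. -/

theorem corollary3p8 :
    ∃ C : ℝ, 0 < C ∧
      ∀ (n : ℕ), 3 ≤ n →
      ∀ (deg : Fin (n - 1) → ℕ), (∀ i, 1 ≤ deg i) →
      ∀ (d : ℕ), d = Finset.univ.sup deg → 2 ≤ d →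
      ∀ (Ω : Type*) [MeasurableSpace Ω] (μ : Measure Ω) [IsProbabilityMeasure μ]
        (X : (i : Fin (n - 1)) → Ω → EuclideanSpace ℝ (RandomSystem.MultiIndex n (deg i)))
        (K c₀ : ℝ), 0 < K → 0 < c₀ →
      (∀ i, Measurable (X i)) →
      iIndepFun X μ →
      (∀ i, RandomSystem.SubGaussianWith μ (X i) K) →
      (∀ i, RandomSystem.SmallBallWith μ (X i) c₀) →
      ∀ (N : ℕ), N = ∑ i, (n + deg i - 1).choose (deg i) →
      ∀ (M : ℝ), M = √(N : ℝ) * (K * c₀ * C) ^ (2 * (n - 1)) *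
          (3 * (d : ℝ) ^ 2 * Real.log (Real.exp 1 * d)) ^ (2 * n - 3) * √(n : ℝ) →
      ∀ (κ : Ω → ℝ≥0∞),
        κ = (fun ω => RandomSystem.kappa deg fun i => RandomSystem.formOfCoeffs (X i ω)) →
      -- the tail bound, in three regimes
      (∀ t : ℝ, 1 ≤ t → t ≤ Real.exp (2 * ((n : ℝ) - 1) * Real.log (Real.exp 1 * d)) →
        μ.real {ω | ENNReal.ofReal (t * M) ≤ κ ω} ≤ 3 * t ^ (-(1 / 2) : ℝ)) ∧
      (∀ t : ℝ, Real.exp (2 * ((n : ℝ) - 1) * Real.log (Real.exp 1 * d)) ≤ t →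
        t ≤ Real.exp (2 * (N : ℝ)) →
        μ.real {ω | ENNReal.ofReal (t * M) ≤ κ ω} ≤ 3 * t ^ (-(1 / 2) : ℝ) *
          (Real.log t / (2 * ((n : ℝ) - 1) * Real.log (Real.exp 1 * d))) ^
            (((n : ℝ) - 3 / 2) / 2)) ∧
      (∀ t : ℝ, Real.exp (2 * (N : ℝ)) ≤ t →
        μ.real {ω | ENNReal.ofReal (t * M) ≤ κ ω} ≤ 3 * t ^ (-(1 / 2) : ℝ) *
          (Real.log t / (2 * (N : ℝ))) ^ (1 / 4 : ℝ) *
          (Real.log t / (2 * ((n : ℝ) - 1) * Real.log (Real.exp 1 * d))) ^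
            (((n : ℝ) - 3 / 2) / 2)) ∧
      -- the moments
      (∀ q : ℝ, 0 < q → q ≤ 1 / 2 - 1 / (4 * Real.log (Real.exp 1 * d)) →
        (∫⁻ ω, κ ω ^ q ∂μ) ^ (1 / q) ≤ ENNReal.ofReal (M * Real.exp (1 / q))) ∧
      -- the logarithm: almost surely a real number, integrable, with bounded expectation
      (∀ᵐ ω ∂μ, κ ω ≠ 0 ∧ κ ω ≠ ∞) ∧
      Integrable (fun ω => Real.log (κ ω).toReal) μ ∧
      ∫ ω, Real.log (κ ω).toReal ∂μ ≤ 1 + Real.log M := by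
  refine ⟨RandomSystem.condConst, by unfold RandomSystem.condConst; positivity, ?_⟩
  intro n hn deg hdeg d hd hd2 Ω _ μ _ X K c₀ hK hc hX hind hsg hsb N hN M hM κ hκ
  obtain ⟨k, rfl⟩ : ∃ k, n = k + 2 := ⟨n - 2, by omega⟩
  obtain ⟨m, hm⟩ : ∃ m, m = k + 2 - 1 := ⟨_, rfl⟩
  have hmk : m = k + 1 := by omega
  have hk : 1 ≤ k := by omega
  have hd0 : (2 : ℝ) ≤ d := by exact_mod_cast hd2
  have hdegd : ∀ i, deg i ≤ d := fun i => hd ▸ Finset.le_sup (Finset.mem_univ i)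
  have hmax : ∃ i, deg i = d := by
    obtain ⟨i, -, hi⟩ := Finset.exists_mem_eq_sup Finset.univ ⟨⟨0, by omega⟩, Finset.mem_univ _⟩ deg
    exact ⟨i, by rw [hd, hi]⟩
  set l := Real.log (Real.exp 1 * d) with hl
  have hl' : l = 1 + Real.log d := by
    rw [hl, Real.log_mul (Real.exp_ne_zero _) (by linarith), Real.log_exp]
  have hl1 : 1 ≤ l := by
    linarith [Real.log_nonneg (by linarith : (1 : ℝ) ≤ d)]
  have hld : l ≤ d := by
    linarith [Real.log_le_sub_one_of_pos (by linarith : (0 : ℝ) < d)]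
  have hm0 : (1 : ℝ) ≤ m := by exact_mod_cast (by omega : 1 ≤ m)
  have hNl : (m : ℝ) * l ≤ N := by
    rw [hN, hm]
    exact RandomSystem.mul_log_le_sum_choose (by omega) (by omega) hmax
  have hml0 : 0 < 2 * (m : ℝ) * l := by positivity
  have hN0 : (0 : ℝ) < 2 * N := by linarith
  have hMle : √(N : ℝ) * ((K * c₀ * RandomSystem.condConst * d * √l) ^ m * d) ^ 2 ≤ M := by
    have hν : 1 ≤ √((k + 2 : ℕ) : ℝ) := by
      apply Real.one_le_sqrt.2
      exact_mod_cast (by omega : 1 ≤ k + 2)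
    refine (RandomSystem.condConst_scale_le (by omega) (by omega) hl1 hν
      (Real.sqrt_nonneg _)).trans (le_of_eq ?_)
    rw [hM, ← hm, show 2 * (k + 2) - 3 = 2 * m - 1 by omega]
  have hM0 : 0 < M := by
    refine lt_of_lt_of_le ?_ hMle
    have : 0 < RandomSystem.condConst := by unfold RandomSystem.condConst; positivity
    have : 0 < √(N : ℝ) := Real.sqrt_pos.2 (by linarith)
    have : 0 < √l := Real.sqrt_pos.2 (by linarith)
    positivity
  have htail : ∀ t : ℝ, 1 ≤ t → μ {ω | ENNReal.ofReal (t * M) ≤ κ ω}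
      ≤ ENNReal.ofReal (t ^ (-(1 / 2) : ℝ) * RandomSystem.tailFactor m l N t / (8 * d)) := by
    intro t ht
    rw [hκ, hm]
    rw [hm] at hMle
    exact RandomSystem.measure_le_kappa_forms_le (by omega) hk hdeg hd2 hdegd hmax hX hind hK hc
      hsg hsb hN hMle ht
  -- For the tail statement the gain `1 / (8d)` is dropped; the three regimes are the ways the two
  -- maxima in `tailFactor` resolve.
  have hreal : ∀ t : ℝ, 1 ≤ t → μ.real {ω | ENNReal.ofReal (t * M) ≤ κ ω}
      ≤ 3 * t ^ (-(1 / 2) : ℝ) * RandomSystem.tailFactor m l N t := by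
    intro t ht
    have hF := RandomSystem.one_le_tailFactor (m := m) (by omega) l N t
    have htp : 0 < t ^ (-(1 / 2) : ℝ) := Real.rpow_pos_of_pos (by linarith) _
    refine (ENNReal.toReal_le_of_le_ofReal (by positivity) (htail t ht)).trans ?_
    refine (div_le_self (by positivity) (by linarith)).trans ?_
    have : 0 < t ^ (-(1 / 2) : ℝ) * RandomSystem.tailFactor m l N t := by positivity
    linarith
  have hmn : ((k + 2 : ℕ) : ℝ) - 1 = m := by rw [hmk]; push_cast; ring
  have hmn' : ((k + 2 : ℕ) : ℝ) - 3 / 2 = m - 1 / 2 := by rw [hmk]; push_cast; ring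
  rw [hmn, hmn']
  have hκm : Measurable κ := by
    rw [hκ]
    exact (RandomSystem.measurable_kappa_forms (k := k) hdeg).comp (measurable_pi_lambda _ hX)
  refine ⟨?_, ?_, ?_, RandomSystem.moments_of_tail hκm (a := 1 / (4 * d)) (D := d) (by positivity)
    hM0 hl1 hld (fun ω => ?_) fun t ht => ?_⟩
  · intro t ht htl
    refine (hreal t ht).trans (le_of_eq ?_)
    have h1 : Real.log t ≤ 2 * m * l := (Real.log_le_iff_le_exp (by linarith)).2 htl
    rw [RandomSystem.tailFactor, max_eq_left ((div_le_one hml0).2 h1),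
      max_eq_left ((div_le_one hN0).2 (by linarith)), Real.one_rpow, Real.one_rpow]
    ring
  · intro t htl htN
    have ht : 1 ≤ t := (Real.one_le_exp hml0.le).trans htl
    refine (hreal t ht).trans (le_of_eq ?_)
    have h1 : 2 * m * l ≤ Real.log t := (Real.le_log_iff_exp_le (by linarith)).2 htl
    have h2 : Real.log t ≤ 2 * N := (Real.log_le_iff_le_exp (by linarith)).2 htN
    rw [RandomSystem.tailFactor, max_eq_right ((one_le_div hml0).2 h1),
      max_eq_left ((div_le_one hN0).2 h2), Real.one_rpow, mul_one]
  · intro t htN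
    have ht : 1 ≤ t := (Real.one_le_exp hN0.le).trans htN
    refine (hreal t ht).trans (le_of_eq ?_)
    have h1 : 2 * N ≤ Real.log t := (Real.le_log_iff_exp_le (by linarith)).2 htN
    rw [RandomSystem.tailFactor, max_eq_right ((one_le_div hml0).2 (by linarith)),
      max_eq_right ((one_le_div hN0).2 h1)]
    ring
  · rw [hκ]
    exact RandomSystem.le_kappa_forms (k := k) hdeg (by omega) hdegd _
  · refine (htail t ht).trans (ENNReal.ofReal_le_ofReal ?_)
    rw [Real.rpow_add (by linarith)]
    have htp : 0 < t ^ (-(1 / 2) : ℝ) := Real.rpow_pos_of_pos (by linarith) _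
    gcongr
    exact RandomSystem.tailFactor_le_rpow (by omega) (by linarith) hNl ht
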